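/- All Hilbert spaces are complex, all operators are bounded, and $\sigma(N)$ denotes the spectrum of $N$. Let $\mathbb{D}=\{z\in\mathbb{C}:|z|<1\}$ and $\mathbb{T}=\{z\in\mathbb{C}:|z|=1\}$. For a non-empty closed set $F\subset\mathbb{C}$ and a continuous function $f:F\to\mathbb{C}$: - $f\in\mathrm{CL}(F)$ ($f$ is commutator Lipschitz) if there is $C\ge 0$ such that $\|f(N)R-Rf(N)\|\le C\|NR-RN\|$ for every operator $R$ and every normal operator $N$ with $\sigma(N)\subset F$ on a Hilbert space; $\|f\|_{\mathrm{CL}(F)}$ is the least such $C$, and $\|f\|_{\mathrm{CL}(F)}=\infty$ if there is none; - $f\in\mathrm{OL}(F)$ ($f$ is operator Lipschitz) if there is $C\ge 0$ such that $\|f(N_1)-f(N_2)\|\le C\|N_1-N_2\|$ for all normal operators $N_1,N_2$ on the same Hilbert space with $\sigma(N_1),\sigma(N_2)\subset F$; $\|f\|_{\mathrm{OL}(F)}$ is the least such $C$, and $\|f\|_{\mathrm{OL}(F)}=\infty$ if there is none. These are seminorms on $\mathrm{CL}(F)$ and $\mathrm{OL}(F)$. One writes $\mathrm{CL}(\mathbb{D})$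 for $\mathrm{CL}(\operatorname{clos}\mathbb{D})$. For a function $f$ on $\operatorname{clos}\mathbb{D}$, the notations $f\in\mathrm{OL}(\mathbb{T})$, $\|f\|_{\mathrm{CL}(\mathbb{T})}$ and $\|f\|_{\mathrm{OL}(\mathbb{T})}$ refer to $f|_{\mathbb{T}}$. Let $C_A$ be the disc algebra, i.e. the space of continuous functions on $\operatorname{clos}\mathbb{D}$ that are analytic in $\mathbb{D}$, and let $(\mathrm{OL})_+(\mathbb{T})$ be the space of those $g\in\mathrm{OL}(\mathbb{T})$ that are restrictions to $\mathbb{T}$ of functions in $C_A$, with the seminorm $\|\cdot\|_{\mathrm{OL}(\mathbb{T})}$. Theorem. 1. If $f\in\mathrm{CL}(\mathbb{D})$, then $f\in C_A$ and $\|f\|_{\mathrm{CL}(\mathbb{D})}=\|f\|_{\mathrm{CL}(\mathbb{T})}=\|f\|_{\mathrm{OL}(\mathbb{T})}$. 2. If $f\in C_A$, then $f\in\mathrm{CL}(\mathbb{D})$ if and only if $f\in\mathrm{OL}(\mathbb{T})$. 3. The restriction map $f\mapsto f|_{\mathbb{T}}$ is a linear bijection of $\mathrm{CL}(\mathbb{D})$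 onto $(\mathrm{OL})_+(\mathbb{T})$ with $\|f|_{\mathbb{T}}\|_{\mathrm{OL}(\mathbb{T})}=\|f\|_{\mathrm{CL}(\mathbb{D})}$ for all $f\in\mathrm{CL}(\mathbb{D})$. -/

import Mathlib

open scoped NNReal ENNReal

universe u

noncomputable section

namespace OpLip

/-- Restriction of continuous functions from a set `F ⊆ ℂ` to a smaller set `E`. -/
def restrictTo {E F : Set ℂ} (h : E ⊆ F) : C(F, ℂ) →ₗ[ℂ] C(E, ℂ) where
  toFun f := f.comp ⟨Set.inclusion h, continuous_inclusion h⟩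
  map_add' _ _ := rfl
  map_smul' _ _ := rfl

section

variable {H : Type u} [NormedAddCommGroup H] [InnerProductSpace ℂ H] [CompleteSpace H]

/-- The operator `f(N)`, for a bounded normal operator `N` on a complex Hilbert space with
spectrum in `F` and a continuous function `f` on `F`. -/
def opApply {F : Set ℂ} (f : C(F, ℂ)) (N : H →L[ℂ] H) (hN : IsStarNormal N)
    (hs : spectrum ℂ N ⊆ F) : H →L[ℂ] H :=
  cfcHom (R := ℂ) hN (restrictTo hs f)

end

/-- `‖f(N) R - R f(N)‖ ≤ C ‖N R - R N‖` for all bounded operators `R` and all bounded normal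
operators `N` with spectrum in `F`, on every complex Hilbert space. -/
def CommLipWith {F : Set ℂ} (C : ℝ≥0) (f : C(F, ℂ)) : Prop :=
  ∀ (H : Type u) [NormedAddCommGroup H] [InnerProductSpace ℂ H] [CompleteSpace H]
    (N R : H →L[ℂ] H) (hN : IsStarNormal N) (hs : spectrum ℂ N ⊆ F),
    ‖opApply f N hN hs * R - R * opApply f N hN hs‖ ≤ C * ‖N * R - R * N‖

/-- `‖f(N₁) - f(N₂)‖ ≤ C ‖N₁ - N₂‖` for all bounded normal operators `N₁`, `N₂` with spectra
in `F`, on every complex Hilbert space. -/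
def OpLipWith {F : Set ℂ} (C : ℝ≥0) (f : C(F, ℂ)) : Prop :=
  ∀ (H : Type u) [NormedAddCommGroup H] [InnerProductSpace ℂ H] [CompleteSpace H]
    (N₁ N₂ : H →L[ℂ] H) (hN₁ : IsStarNormal N₁) (hN₂ : IsStarNormal N₂)
    (hs₁ : spectrum ℂ N₁ ⊆ F) (hs₂ : spectrum ℂ N₂ ⊆ F),
    ‖opApply f N₁ hN₁ hs₁ - opApply f N₂ hN₂ hs₂‖ ≤ C * ‖N₁ - N₂‖

/-- The space `CL(F)` of commutator Lipschitz functions on `F`. -/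
def CL (F : Set ℂ) : Submodule ℂ C(F, ℂ) where
  carrier := {f | ∃ C : ℝ≥0, CommLipWith.{u} C f}
  zero_mem' := ⟨0, fun H _ _ _ N R hN hs => by simp [opApply]⟩
  add_mem' := by
    rintro f g ⟨C, hC⟩ ⟨D, hD⟩
    refine ⟨C + D, fun H _ _ _ N R hN hs => ?_⟩
    have h : opApply (f + g) N hN hs = opApply f N hN hs + opApply g N hN hs := by
      simp [opApply]
    rw [h, add_mul, mul_add, add_sub_add_comm, NNReal.coe_add, add_mul]
    exact (norm_add_le _ _).trans (add_le_add (hC H N R hN hs) (hD H N R hN hs))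
  smul_mem' := by
    rintro c f ⟨C, hC⟩
    refine ⟨‖c‖₊ * C, fun H _ _ _ N R hN hs => ?_⟩
    have h : opApply (c • f) N hN hs = c • opApply f N hN hs := by
      simp [opApply]
    rw [h, smul_mul_assoc, mul_smul_comm, ← smul_sub, norm_smul, NNReal.coe_mul, coe_nnnorm,
      mul_assoc]
    exact mul_le_mul_of_nonneg_left (hC H N R hN hs) (norm_nonneg c)

/-- The space `OL(F)` of operator Lipschitz functions on `F`. -/
def OL (F : Set ℂ) : Submodule ℂ C(F, ℂ) where
  carrier := {f | ∃ C : ℝ≥0, OpLipWith.{u} C f}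
  zero_mem' := ⟨0, fun H _ _ _ N₁ N₂ h₁ h₂ hs₁ hs₂ => by simp [opApply]⟩
  add_mem' := by
    rintro f g ⟨C, hC⟩ ⟨D, hD⟩
    refine ⟨C + D, fun H _ _ _ N₁ N₂ h₁ h₂ hs₁ hs₂ => ?_⟩
    have h : ∀ (N : H →L[ℂ] H) (hN : IsStarNormal N) (hs : spectrum ℂ N ⊆ F),
        opApply (f + g) N hN hs = opApply f N hN hs + opApply g N hN hs := by
      intros; simp [opApply]
    rw [h, h, add_sub_add_comm, NNReal.coe_add, add_mul]
    exact (norm_add_le _ _).trans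
      (add_le_add (hC H N₁ N₂ h₁ h₂ hs₁ hs₂) (hD H N₁ N₂ h₁ h₂ hs₁ hs₂))
  smul_mem' := by
    rintro c f ⟨C, hC⟩
    refine ⟨‖c‖₊ * C, fun H _ _ _ N₁ N₂ h₁ h₂ hs₁ hs₂ => ?_⟩
    have h : ∀ (N : H →L[ℂ] H) (hN : IsStarNormal N) (hs : spectrum ℂ N ⊆ F),
        opApply (c • f) N hN hs = c • opApply f N hN hs := by
      intros; simp [opApply]
    rw [h, h, ← smul_sub, norm_smul, NNReal.coe_mul, coe_nnnorm, mul_assoc]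
    exact mul_le_mul_of_nonneg_left (hC H N₁ N₂ h₁ h₂ hs₁ hs₂) (norm_nonneg c)

/-- The seminorm `‖f‖_{CL(F)}`: the least admissible constant, and `∞` if there is none. -/
def normCL {F : Set ℂ} (f : C(F, ℂ)) : ℝ≥0∞ :=
  ⨅ (C : ℝ≥0) (_ : CommLipWith.{u} C f), (C : ℝ≥0∞)

/-- The seminorm `‖f‖_{OL(F)}`: the least admissible constant, and `∞` if there is none. -/
def normOL {F : Set ℂ} (f : C(F, ℂ)) : ℝ≥0∞ :=
  ⨅ (C : ℝ≥0) (_ : OpLipWith.{u} C f), (C : ℝ≥0∞)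

/-- The closed unit disc; `CL(𝔻)` means `CL` of this set. -/
abbrev closedDisc : Set ℂ := Metric.closedBall 0 1

/-- The unit circle `𝕋`. -/
abbrev unitCircle : Set ℂ := Metric.sphere 0 1

/-- The boundary values `f|_𝕋` of a continuous function on the closed disc. -/
def toCircle : C(closedDisc, ℂ) →ₗ[ℂ] C(unitCircle, ℂ) :=
  restrictTo Metric.sphere_subset_closedBall

/-- The disc algebra: continuous functions on the closed unit disc, analytic in the open one.
(The extension by `0` outside the closed disc does not affect analyticity in the open disc.) -/
def discAlgebra : Submodule ℂ C(closedDisc, ℂ) where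
  carrier := {f | AnalyticOnNhd ℂ (Function.extend Subtype.val f 0) (Metric.ball 0 1)}
  zero_mem' := by
    have h : Function.extend Subtype.val (⇑(0 : C(closedDisc, ℂ))) (0 : ℂ → ℂ) = 0 := by
      ext z; simp [Function.extend]
    rw [Set.mem_ofPred_eq, h]
    exact analyticOnNhd_const
  add_mem' := by
    intro f g hf hg
    have h : Function.extend Subtype.val (⇑(f + g)) (0 : ℂ → ℂ)
        = Function.extend Subtype.val f 0 + Function.extend Subtype.val g 0 := by
      ext z; by_cases hz : ∃ a : closedDisc, a.val = z <;> simp [Function.extend, hz]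
    rw [Set.mem_ofPred_eq, h]
    exact AnalyticOnNhd.add hf hg
  smul_mem' := by
    intro c f hf
    have h : Function.extend Subtype.val (⇑(c • f)) (0 : ℂ → ℂ)
        = c • Function.extend Subtype.val f 0 := by
      ext z; by_cases hz : ∃ a : closedDisc, a.val = z <;> simp [Function.extend, hz]
    rw [Set.mem_ofPred_eq, h]
    exact AnalyticOnNhd.const_smul hf

/-- The space `(OL)₊(𝕋)`: functions in `OL(𝕋)` that are the boundary values of a function
continuous on the closed disc and analytic in the open disc. -/
def OLplus : Submodule ℂ C(unitCircle, ℂ) :=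
  OL.{u} unitCircle ⊓ discAlgebra.map toCircle

end OpLip

end

/-! All comparisons are made at a fixed constant `C`, so the equalities of seminorms and of spaces
come out together: the sets of admissible constants coincide.

Commutator and operator Lipschitz bounds. On a compact set, a commutator bound for the direct sum of
two representations, tested on an off-diagonal block, bounds `f(N₁)A - A f(N₂)`; `A = 1` is the
operator Lipschitz bound. Conversely, unitary conjugation bounds commutators with unitaries,
differentiating `exp(itA)` at `0` gives self-adjoint `A`, and the self-adjoint block with entries
`R` and `R*` gives arbitrary `R`. No constant is lost on the circle, because a unitary has equally
large commutators with `R` and `R*`.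

From the circle to the disc. For a polynomial, the commutator of `p(N)` with `R` is a divided
difference applied to `NR - RN`. The circle bound controls this divided difference on every operator
when `N` is unitary of finite order. Strict contractions are limits of compressions of such
unitaries (a finite dilation), so the bound passes to them and then to all contractions. A function
of the disc algebra is reached through Poisson averages of its rotations, Taylor polynomials and
dilations `f(wz)` with `w → 1`.

Analyticity. A commutator bound makes the matrices of difference quotients bounded Schur
multipliers. If the slopes at an interior point had two cluster values `a ≠ b`, points approaching
it very fast would make a triangular pattern of `a` and `b` a bounded Schur multiplier. The Hilbert
matrix forbids this: its norm is at most `π`, but its entries weighted by the pattern sum to order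
`n log n`. Hence the slopes converge. Injectivity of the restriction is the maximum principle. -/

noncomputable section

/-! ### Functional calculus as representations of `C(F, ℂ)` -/

namespace OpLip

/-- The inclusion of `F` into `ℂ`, as a continuous function. -/
def coord (F : Set ℂ) : C(F, ℂ) := ⟨Subtype.val, continuous_subtype_val⟩

section Rep

variable {H : Type*} [NormedAddCommGroup H] [InnerProductSpace ℂ H] [CompleteSpace H]

/-- The continuous functional calculus of a normal operator, as a representation of `C(F, ℂ)`. -/
def opHom {F : Set ℂ} (N : H →L[ℂ] H) (hN : IsStarNormal N) (hs : spectrum ℂ N ⊆ F) :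
    C(F, ℂ) →⋆ₐ[ℂ] (H →L[ℂ] H) :=
  (cfcHom (R := ℂ) hN).comp
    (ContinuousMap.compStarAlgHom' ℂ ℂ ⟨Set.inclusion hs, continuous_inclusion hs⟩)

theorem opHom_apply {F : Set ℂ} (f : C(F, ℂ)) (N : H →L[ℂ] H) (hN : IsStarNormal N)
    (hs : spectrum ℂ N ⊆ F) : opHom N hN hs f = opApply f N hN hs := rfl

theorem opHom_coord {F : Set ℂ} (N : H →L[ℂ] H) (hN : IsStarNormal N)
    (hs : spectrum ℂ N ⊆ F) : opHom N hN hs (coord F) = N :=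
  cfcHom_id hN

theorem isStarNormal_map_coord {F : Set ℂ} (ψ : C(F, ℂ) →⋆ₐ[ℂ] (H →L[ℂ] H)) :
    IsStarNormal (ψ (coord F)) :=
  ⟨by rw [Commute, SemiconjBy, ← map_star, ← map_mul, ← map_mul, mul_comm]⟩

theorem spectrum_map_coord_subset {F : Set ℂ} [CompactSpace F]
    (ψ : C(F, ℂ) →⋆ₐ[ℂ] (H →L[ℂ] H)) : spectrum ℂ (ψ (coord F)) ⊆ F := by
  refine (AlgHom.spectrum_apply_subset ψ (coord F)).trans ?_
  rw [ContinuousMap.spectrum_eq_range]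
  rintro _ ⟨x, rfl⟩
  exact x.2

-- By Stone–Weierstrass a representation of `C(F, ℂ)` is determined by the image of the coordinate,
-- so normal operators with spectrum in `F` and representations are the same data.
open scoped CStarAlgebra in
theorem opApply_map_coord {F : Set ℂ} [CompactSpace F] (ψ : C(F, ℂ) →⋆ₐ[ℂ] (H →L[ℂ] H))
    (f : C(F, ℂ)) :
    opApply f (ψ (coord F)) (isStarNormal_map_coord ψ) (spectrum_map_coord_subset ψ) = ψ f := by
  have : opHom _ (isStarNormal_map_coord ψ) (spectrum_map_coord_subset ψ) = ψ :=
    ContinuousMap.UniqueHom.eq_of_continuous_of_map_id F _ _ (map_continuous _)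
      (map_continuous _) (opHom_coord _ _ _)
  exact DFunLike.congr_fun this f

end Rep

/-- Representations carry no proofs of normality or spectral inclusion, and they can be added
directly and composed with self-maps of `F`. -/
theorem commLipWith_iff {F : Set ℂ} [CompactSpace F] {C : ℝ≥0} {f : C(F, ℂ)} :
    CommLipWith.{u} C f ↔
      ∀ (H : Type u) [NormedAddCommGroup H] [InnerProductSpace ℂ H] [CompleteSpace H]
        (ψ : C(F, ℂ) →⋆ₐ[ℂ] (H →L[ℂ] H)) (R : H →L[ℂ] H),
        ‖ψ f * R - R * ψ f‖ ≤ C * ‖ψ (coord F) * R - R * ψ (coord F)‖ := by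
  refine ⟨fun h H _ _ _ ψ R => ?_, fun h H _ _ _ N R hN hs => ?_⟩
  · simpa only [opApply_map_coord] using
      h H (ψ (coord F)) R (isStarNormal_map_coord ψ) (spectrum_map_coord_subset ψ)
  · simpa only [opHom_coord, ← opHom_apply] using h H (opHom N hN hs) R

theorem opLipWith_iff {F : Set ℂ} [CompactSpace F] {C : ℝ≥0} {f : C(F, ℂ)} :
    OpLipWith.{u} C f ↔
      ∀ (H : Type u) [NormedAddCommGroup H] [InnerProductSpace ℂ H] [CompleteSpace H]
        (ψ₁ ψ₂ : C(F, ℂ) →⋆ₐ[ℂ] (H →L[ℂ] H)),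
        ‖ψ₁ f - ψ₂ f‖ ≤ C * ‖ψ₁ (coord F) - ψ₂ (coord F)‖ := by
  refine ⟨fun h H _ _ _ ψ₁ ψ₂ => ?_, fun h H _ _ _ N₁ N₂ h₁ h₂ hs₁ hs₂ => ?_⟩
  · simpa only [opApply_map_coord] using
      h H _ _ (isStarNormal_map_coord ψ₁) (isStarNormal_map_coord ψ₂)
        (spectrum_map_coord_subset ψ₁) (spectrum_map_coord_subset ψ₂)
  · simpa only [opHom_coord, ← opHom_apply] using h H (opHom N₁ h₁ hs₁) (opHom N₂ h₂ hs₂)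

theorem CommLipWith.restrictTo {E F : Set ℂ} {C : ℝ≥0} {f : C(F, ℂ)} (hf : CommLipWith.{u} C f)
    (h : E ⊆ F) : CommLipWith.{u} C (restrictTo h f) :=
  fun H _ _ _ N R hN hs => hf H N R hN (hs.trans h)

/-! ### Block operators and intertwiners -/

section Block

variable {H : Type*} [NormedAddCommGroup H] [InnerProductSpace ℂ H]

/-- The operator with block matrix `!![A, B; C, D]` on `H ⊕ H`. -/
def block (A B C D : H →L[ℂ] H) : WithLp 2 (H × H) →L[ℂ] WithLp 2 (H × H) :=
  (WithLp.prodContinuousLinearEquiv 2 ℂ H H).symm.toContinuousLinearMap ∘L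
    ((A.coprod B).prod (C.coprod D)) ∘L
    (WithLp.prodContinuousLinearEquiv 2 ℂ H H).toContinuousLinearMap

variable (A B C D A' B' C' D' : H →L[ℂ] H)

@[simp] theorem block_apply_fst (x : WithLp 2 (H × H)) :
    (block A B C D x).fst = A x.fst + B x.snd := rfl

@[simp] theorem block_apply_snd (x : WithLp 2 (H × H)) :
    (block A B C D x).snd = C x.fst + D x.snd := rfl

theorem withLp_prod_ext {V : Type*} {x y : WithLp 2 (V × V)} (h₁ : x.fst = y.fst) (h₂ : x.snd = y.snd) :
    x = y := WithLp.ofLp_injective 2 (Prod.ext h₁ h₂)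

theorem block_mul : block A B C D * block A' B' C' D' =
    block (A * A' + B * C') (A * B' + B * D') (C * A' + D * C') (C * B' + D * D') := by
  ext x
  refine withLp_prod_ext ?_ ?_ <;> simp <;> abel

theorem block_sub : block A B C D - block A' B' C' D' =
    block (A - A') (B - B') (C - C') (D - D') := by
  ext x
  refine withLp_prod_ext ?_ ?_ <;> simp <;> abel

theorem block_add : block A B C D + block A' B' C' D' =
    block (A + A') (B + B') (C + C') (D + D') := by
  ext x
  refine withLp_prod_ext ?_ ?_ <;> simp <;> abel

theorem block_one : block (1 : H →L[ℂ] H) 0 0 1 = 1 := by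
  ext x
  refine withLp_prod_ext ?_ ?_ <;> simp

theorem block_zero : block (0 : H →L[ℂ] H) 0 0 0 = 0 := by
  ext x
  refine withLp_prod_ext ?_ ?_ <;> simp

theorem smul_block (c : ℂ) : c • block A B C D = block (c • A) (c • B) (c • C) (c • D) := by
  ext x
  refine withLp_prod_ext ?_ ?_ <;> simp

theorem star_block [CompleteSpace H] :
    star (block A B C D) = block (star A) (star C) (star B) (star D) := by
  symm
  rw [ContinuousLinearMap.star_eq_adjoint (block A B C D), ContinuousLinearMap.eq_adjoint_iff]
  intro x y
  simp only [WithLp.prod_inner_apply, ContinuousLinearMap.star_eq_adjoint]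
  change inner ℂ (block _ _ _ _ x).fst y.fst + inner ℂ (block _ _ _ _ x).snd y.snd =
    inner ℂ x.fst (block _ _ _ _ y).fst + inner ℂ x.snd (block _ _ _ _ y).snd
  simp only [block_apply_fst, block_apply_snd, inner_add_left, inner_add_right,
    ContinuousLinearMap.adjoint_inner_left]
  ring

/-- An off-diagonal block operator is as large as its larger entry. -/
theorem norm_block_offDiag_le {M : ℝ} (hM : 0 ≤ M) (hB : ‖B‖ ≤ M) (hC : ‖C‖ ≤ M) :
    ‖block 0 B C 0‖ ≤ M := by
  refine ContinuousLinearMap.opNorm_le_bound _ hM fun x => ?_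
  have h₁ := B.le_of_opNorm_le hB x.snd
  have h₂ := C.le_of_opNorm_le hC x.fst
  refine (sq_le_sq₀ (norm_nonneg _) (by positivity)).1 ?_
  rw [mul_pow, WithLp.prod_norm_sq_eq_of_L2, WithLp.prod_norm_sq_eq_of_L2]
  simp only [block_apply_fst, block_apply_snd, zero_apply, zero_add, add_zero]
  have h₃ := pow_le_pow_left₀ (norm_nonneg _) h₁ 2
  have h₄ := pow_le_pow_left₀ (norm_nonneg _) h₂ 2
  rw [mul_pow] at h₃ h₄
  linarith

theorem norm_le_norm_block : ‖B‖ ≤ ‖block A B C D‖ := by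
  refine ContinuousLinearMap.opNorm_le_bound _ (norm_nonneg (block A B C D)) fun x => ?_
  have h := (block A B C D).le_opNorm (WithLp.toLp 2 (0, x))
  have h₁ : ‖(WithLp.toLp 2 (0, x) : WithLp 2 (H × H))‖ = ‖x‖ := by
    simp
  have h₂ : ‖B x‖ ≤ ‖block A B C D (WithLp.toLp 2 (0, x))‖ := by
    rw [WithLp.prod_norm_eq_of_L2]
    refine Real.le_sqrt_of_sq_le ?_
    simp only [block_apply_fst]
    simp
  rw [h₁] at h
  exact h₂.trans h

end Block

section BlockRep

variable {H : Type*} [NormedAddCommGroup H] [InnerProductSpace ℂ H] [CompleteSpace H]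

/-- The direct sum of two representations on the same Hilbert space. -/
def directSum {F : Set ℂ} (ψ₁ ψ₂ : C(F, ℂ) →⋆ₐ[ℂ] (H →L[ℂ] H)) :
    C(F, ℂ) →⋆ₐ[ℂ] (WithLp 2 (H × H) →L[ℂ] WithLp 2 (H × H)) where
  toFun f := block (ψ₁ f) 0 0 (ψ₂ f)
  map_one' := by simp [block_one]
  map_mul' f g := by simp [block_mul]
  map_zero' := by simp [block_zero]
  map_add' f g := by simp [block_add]
  commutes' c := by 
    rw [AlgHomClass.commutes, AlgHomClass.commutes, Algebra.algebraMap_eq_smul_one,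
      Algebra.algebraMap_eq_smul_one, ← block_one, smul_block, smul_zero]
  map_star' f := by simp [star_block, map_star]

theorem directSum_apply {F : Set ℂ} (ψ₁ ψ₂ : C(F, ℂ) →⋆ₐ[ℂ] (H →L[ℂ] H)) (f : C(F, ℂ)) :
    directSum ψ₁ ψ₂ f = block (ψ₁ f) 0 0 (ψ₂ f) := rfl

end BlockRep

/-- The inequality for commutators implies the one for intertwiners of two normal operators. -/
theorem CommLipWith.norm_mul_sub_mul_le {F : Set ℂ} [CompactSpace F] {C : ℝ≥0} {f : C(F, ℂ)}
    (hf : CommLipWith.{u} C f) {H : Type u} [NormedAddCommGroup H] [InnerProductSpace ℂ H]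
    [CompleteSpace H] (ψ₁ ψ₂ : C(F, ℂ) →⋆ₐ[ℂ] (H →L[ℂ] H)) (A : H →L[ℂ] H) :
    ‖ψ₁ f * A - A * ψ₂ f‖ ≤ C * ‖ψ₁ (coord F) * A - A * ψ₂ (coord F)‖ := by
  have key : ∀ g : C(F, ℂ), directSum ψ₁ ψ₂ g * block 0 A 0 0 - block 0 A 0 0 * directSum ψ₁ ψ₂ g =
      block 0 (ψ₁ g * A - A * ψ₂ g) 0 0 := fun g => by
    simp [directSum_apply, block_mul, block_sub]
  have h := commLipWith_iff.1 hf _ (directSum ψ₁ ψ₂) (block 0 A 0 0)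
  rw [key, key] at h
  refine (norm_le_norm_block _ _ _ _).trans (h.trans ?_)
  gcongr
  exact norm_block_offDiag_le _ _ (norm_nonneg _) le_rfl (by simp)

theorem CommLipWith.opLipWith {F : Set ℂ} [CompactSpace F] {C : ℝ≥0} {f : C(F, ℂ)}
    (hf : CommLipWith.{u} C f) : OpLipWith.{u} C f :=
  opLipWith_iff.2 fun H _ _ _ ψ₁ ψ₂ => by simpa using hf.norm_mul_sub_mul_le ψ₁ ψ₂ 1

end OpLip

/-! ### From operator Lipschitz to commutator Lipschitz on the circle -/

namespace OpLip

section Exp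

open NormedSpace Filter Topology

variable {H : Type u} [NormedAddCommGroup H] [InnerProductSpace ℂ H] [CompleteSpace H]

/-- The functional calculus commutes with conjugation by `V`, and `‖T - V T V*‖ = ‖T V - V T‖`. -/
theorem OpLipWith.norm_commutator_unitary_le {F : Set ℂ} [CompactSpace F] {C : ℝ≥0} {f : C(F, ℂ)}
    (hf : OpLipWith.{u} C f) (ψ : C(F, ℂ) →⋆ₐ[ℂ] (H →L[ℂ] H)) (V : unitary (H →L[ℂ] H)) :
    ‖ψ f * V - V * ψ f‖ ≤ C * ‖ψ (coord F) * V - V * ψ (coord F)‖ := by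
  have key : ∀ T : H →L[ℂ] H,
      ‖T - Unitary.conjStarAlgAut ℂ (H →L[ℂ] H) V T‖ = ‖T * V - V * T‖ := fun T => by
    rw [← CStarRing.norm_mul_coe_unitary _ V, Unitary.conjStarAlgAut_apply, sub_mul,
      mul_assoc _ _ (V : H →L[ℂ] H), Unitary.coe_star_mul_self, mul_one]
  have := opLipWith_iff.1 hf H ψ
    ((Unitary.conjStarAlgAut ℂ (H →L[ℂ] H) V : (H →L[ℂ] H) →⋆ₐ[ℂ] (H →L[ℂ] H)).comp ψ)
  simpa only [StarAlgHom.comp_apply, StarAlgHom.coe_coe, key] using this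

theorem tendsto_commutator_exp (T A : H →L[ℂ] H) :
    Tendsto (fun t : ℝ => t⁻¹ • (T * exp (t • A) - exp (t • A) * T)) (𝓝[≠] 0)
      (𝓝 (T * A - A * T)) := by
  have h : HasDerivAt (fun t : ℝ => exp (t • A)) A 0 := by
    simpa using hasDerivAt_exp_smul_const (𝕂 := ℝ) A (0 : ℝ)
  have h' := hasDerivAt_iff_tendsto_slope.1 ((h.const_mul T).sub (h.mul_const T))
  refine h'.congr fun t => ?_
  simp [slope_def_module]

theorem OpLipWith.norm_commutator_selfAdjoint_le {F : Set ℂ} [CompactSpace F] {C : ℝ≥0}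
    {f : C(F, ℂ)} (hf : OpLipWith.{u} C f) (ψ : C(F, ℂ) →⋆ₐ[ℂ] (H →L[ℂ] H))
    (A : selfAdjoint (H →L[ℂ] H)) :
    ‖ψ f * A - A * ψ f‖ ≤ C * ‖ψ (coord F) * A - A * ψ (coord F)‖ := by
  -- The factor `I` makes `exp(t I A)` unitary and does not change the norms of commutators.
  have hn : ∀ T : H →L[ℂ] H, ‖T * (Complex.I • (A : H →L[ℂ] H)) - (Complex.I • A) * T‖ =
      ‖T * A - A * T‖ := fun T => by
    rw [mul_smul_comm, smul_mul_assoc, ← smul_sub, norm_smul, Complex.norm_I, one_mul]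
  rw [← hn, ← hn]
  refine le_of_tendsto_of_tendsto (tendsto_commutator_exp _ _).norm
    ((tendsto_commutator_exp _ _).norm.const_mul _) (Eventually.of_forall fun t => ?_)
  have h := hf.norm_commutator_unitary_le ψ (selfAdjoint.expUnitary (t • A))
  rw [selfAdjoint.expUnitary_coe] at h
  have h2 : Complex.I • ((t • A : selfAdjoint (H →L[ℂ] H)) : H →L[ℂ] H) =
      t • (Complex.I • (A : H →L[ℂ] H)) := by
    rw [selfAdjoint.val_smul, smul_comm]
  rw [h2] at h
  simp only [norm_smul]
  rw [mul_left_comm]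
  gcongr

end Exp

/-- On the circle, operator Lipschitz functions are commutator Lipschitz. -/
theorem OpLipWith.commLipWith {C : ℝ≥0} {f : C(unitCircle, ℂ)} (hf : OpLipWith.{u} C f) :
    CommLipWith.{u} C f := by
  refine commLipWith_iff.2 fun H _ _ _ ψ R => ?_
  -- A self-adjoint operator having `R` as a corner: its commutators contain those of `R` and of
  -- `star R`.
  have key : ∀ g, directSum ψ ψ g * block 0 R (star R) 0 - block 0 R (star R) 0 * directSum ψ ψ g =
      block 0 (ψ g * R - R * ψ g) (ψ g * star R - star R * ψ g) 0 := fun g => by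
    simp [directSum_apply, block_mul, block_sub]
  have hsa : IsSelfAdjoint (block 0 R (star R) 0) := by
    simp [IsSelfAdjoint, star_block]
  have h := hf.norm_commutator_selfAdjoint_le (directSum ψ ψ) ⟨_, hsa⟩
  simp only [key] at h
  refine (norm_le_norm_block _ _ _ _).trans (h.trans ?_)
  gcongr
  refine norm_block_offDiag_le _ _ (norm_nonneg _) le_rfl (le_of_eq ?_)
  have hX : coord unitCircle ∈ unitary C(unitCircle, ℂ) := by
    have : star (coord unitCircle) * coord unitCircle = 1 := by
      ext z
      have hz : ‖(z : ℂ)‖ = 1 := mem_sphere_zero_iff_norm.1 z.2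
      simp [coord, Complex.conj_mul', hz]
    exact ⟨this, by rw [mul_comm, this]⟩
  have hU : ψ (coord unitCircle) ∈ unitary (H →L[ℂ] H) := Unitary.map_mem ψ hX
  set U : unitary (H →L[ℂ] H) := ⟨_, hU⟩
  change ‖(U : H →L[ℂ] H) * star R - star R * U‖ = ‖(U : H →L[ℂ] H) * R - R * U‖
  -- Sandwiching the adjoint of `U R* - R* U` between two copies of `U` gives `U R - R U`, without
  -- changing the norm.
  rw [← norm_star, ← CStarRing.norm_mul_coe_unitary _ U, ← CStarRing.norm_coe_unitary_mul U]
  congr 1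
  simp only [star_sub, star_mul, star_star, sub_mul, mul_sub]
  rw [mul_assoc R, show star (U : H →L[ℂ] H) * U = 1 from hU.1, mul_one,
    ← mul_assoc, ← mul_assoc, show (U : H →L[ℂ] H) * star (U : H →L[ℂ] H) = 1 from hU.2,
    one_mul]

end OpLip

/-! ### Polynomials: from the circle to the disc by dilation -/

namespace OpLip

open Filter Topology Finset

/-- The noncommutative divided difference of the polynomial `∑ k < n, a k * z ^ k`. -/
def dividedDiff {A : Type*} [Ring A] [Module ℂ A] (n : ℕ) (a : ℕ → ℂ) (S T X : A) : A :=
  ∑ k ∈ range n, a k • ∑ i ∈ range k, S ^ i * X * T ^ (k - 1 - i)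

theorem pow_mul_sub_mul_pow {A : Type*} [Ring A] (S T R : A) (k : ℕ) :
    S ^ k * R - R * T ^ k = ∑ i ∈ range k, S ^ i * (S * R - R * T) * T ^ (k - 1 - i) := by
  have h := sum_range_sub (fun i => S ^ i * R * T ^ (k - i)) k
  simp only [Nat.sub_self, pow_zero, mul_one, one_mul, Nat.sub_zero] at h
  rw [← h]
  refine sum_congr rfl fun i hi => ?_
  have hi := mem_range.1 hi
  obtain ⟨j, rfl⟩ : ∃ j, k = i + 1 + j := ⟨k - (i + 1), by omega⟩
  rw [show i + 1 + j - (i + 1) = j by omega, show i + 1 + j - i = j + 1 by omega,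
    show i + 1 + j - 1 - i = j by omega, pow_succ, pow_succ']
  noncomm_ring

/-- The left side depends on `R` only through `S R - R T`, by the telescoping of
`pow_mul_sub_mul_pow`. Extending the bound to all arguments `X` detaches it from the commutator
equation. -/
theorem dividedDiff_commutator {A : Type*} [Ring A] [Algebra ℂ A] (n : ℕ) (a : ℕ → ℂ)
    (S T R : A) :
    (∑ k ∈ range n, a k • S ^ k) * R - R * ∑ k ∈ range n, a k • T ^ k =
      dividedDiff n a S T (S * R - R * T) := by
  simp only [dividedDiff, ← pow_mul_sub_mul_pow, sum_mul, mul_sum, ← sum_sub_distrib, smul_sub,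
    smul_mul_assoc, mul_smul_comm]

/-- The polynomial `∑ k < n, a k * z ^ k`, as a continuous function on `F`. -/
def polyFun (F : Set ℂ) (n : ℕ) (a : ℕ → ℂ) : C(F, ℂ) := ∑ k ∈ range n, a k • coord F ^ k

section

variable {H : Type u} [NormedAddCommGroup H] [InnerProductSpace ℂ H] [CompleteSpace H]

theorem map_polyFun {F : Set ℂ} (ψ : C(F, ℂ) →⋆ₐ[ℂ] (H →L[ℂ] H)) (n : ℕ) (a : ℕ → ℂ) :
    ψ (polyFun F n a) = ∑ k ∈ range n, a k • ψ (coord F) ^ k := by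
  simp [polyFun, map_sum, map_smul, map_pow]

theorem exists_rep_of_mem_unitary {U : H →L[ℂ] H} (hU : U ∈ unitary (H →L[ℂ] H)) :
    ∃ ψ : C(unitCircle, ℂ) →⋆ₐ[ℂ] (H →L[ℂ] H), ψ (coord unitCircle) = U :=
  ⟨opHom U (isStarNormal_of_mem_unitary hU) (spectrum.subset_circle_of_unitary hU),
    opHom_coord _ _ _⟩

/-- The twist by `η` makes `U R - R (η U) = Y` solvable for every `Y`, which fails for `η = 1`. -/
theorem CommLipWith.norm_dividedDiff_smul_le {C : ℝ≥0} {n : ℕ} {a : ℕ → ℂ}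
    (h : CommLipWith.{u} C (polyFun unitCircle n a)) {U : H →L[ℂ] H}
    (hU : U ∈ unitary (H →L[ℂ] H)) {m : ℕ} (hm : U ^ m = 1) {η : ℂ} (hη : ‖η‖ = 1)
    (hηm : η ^ m ≠ 1) (Y : H →L[ℂ] H) : ‖dividedDiff n a U (η • U) Y‖ ≤ C * ‖Y‖ := by
  have hηU : η • U ∈ unitary (H →L[ℂ] H) := by
    have : star η * η = 1 := by simp [Complex.conj_mul', hη]
    constructor
    · rw [star_smul, smul_mul_smul_comm, hU.1, this, one_smul]
    · rw [star_smul, smul_mul_smul_comm, hU.2, mul_comm, this, one_smul]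
  obtain ⟨ψ₁, h₁⟩ := exists_rep_of_mem_unitary hU
  obtain ⟨ψ₂, h₂⟩ := exists_rep_of_mem_unitary hηU
  -- One period of the formal Neumann series: the sum telescopes to `Y - η ^ m Y` because `U ^ m =
  -- 1`.
  set R : H →L[ℂ] H := (1 - η ^ m)⁻¹ • ∑ k ∈ range m, η ^ k • (star U ^ (k + 1) * Y * U ^ k)
  have hR : U * R - R * (η • U) = Y := by
    have hne : 1 - η ^ m ≠ 0 := sub_ne_zero.2 hηm.symm
    have hsum := sum_range_sub' (fun k => η ^ k • (star U ^ k * Y * U ^ k)) m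
    have hUm : star U ^ m = 1 := by rw [← star_pow, hm, star_one]
    simp only [hm, hUm, pow_zero, one_mul, mul_one, one_smul] at hsum
    have : (1 - η ^ m) • (U * R - R * (η • U)) = (1 - η ^ m) • Y := by
      rw [sub_smul _ _ Y, one_smul, ← hsum, mul_smul_comm, smul_mul_assoc, ← smul_sub, smul_smul,
        mul_inv_cancel₀ hne, one_smul, mul_sum, sum_mul, ← sum_sub_distrib]
      refine sum_congr rfl fun k _ => ?_
      rw [mul_smul_comm, smul_mul_smul_comm, ← pow_succ, mul_assoc _ _ U, ← pow_succ, pow_succ' _ k,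
        mul_assoc (star U), mul_assoc (star U), ← mul_assoc U, hU.2, one_mul, mul_assoc (star U),
        pow_succ' η]
    exact smul_right_injective _ hne this
  have key := h.norm_mul_sub_mul_le ψ₁ ψ₂ R
  rwa [map_polyFun, map_polyFun, h₁, h₂, dividedDiff_commutator, hR] at key

/-- Let `η = exp(it) → 1`; near `t = 0`, `η ^ m` takes the value `1` only at `t = 0`, its derivative
there being `m I`. -/
theorem CommLipWith.norm_dividedDiff_periodic_le {C : ℝ≥0} {n : ℕ} {a : ℕ → ℂ}
    (h : CommLipWith.{u} C (polyFun unitCircle n a)) {U : H →L[ℂ] H}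
    (hU : U ∈ unitary (H →L[ℂ] H)) {m : ℕ} (hm : U ^ m = 1) (hm0 : m ≠ 0) (Y : H →L[ℂ] H) :
    ‖dividedDiff n a U U Y‖ ≤ C * ‖Y‖ := by
  have hc : Continuous fun t : ℝ => dividedDiff n a U (Complex.exp (t * Complex.I) • U) Y := by
    unfold dividedDiff
    fun_prop
  have hlim : Tendsto (fun t : ℝ => dividedDiff n a U (Complex.exp (t * Complex.I) • U) Y)
      (𝓝[≠] 0) (𝓝 (dividedDiff n a U U Y)) := by
    simpa using (hc.tendsto 0).mono_left nhdsWithin_le_nhds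
  have hd : HasDerivAt (fun t : ℝ => Complex.exp (t * Complex.I) ^ m) (m * Complex.I) 0 := by
    have h₁ : HasDerivAt (fun t : ℝ => (t : ℂ) * Complex.I) (1 * Complex.I) 0 :=
      (Complex.ofRealCLM.hasDerivAt (x := (0 : ℝ))).mul_const Complex.I
    simpa using h₁.cexp.fun_pow m
  refine le_of_tendsto hlim.norm ?_
  filter_upwards [hd.eventually_ne (c := 1) (by simp [hm0])] with t ht
  exact h.norm_dividedDiff_smul_le hU hm (Complex.norm_exp_ofReal_mul_I t) ht Y

/-- The cyclic shift on `L + 1` copies of `H`. -/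
def cyclicShift (H : Type u) [NormedAddCommGroup H] [InnerProductSpace ℂ H] (L : ℕ) :
    PiLp 2 (fun _ : Fin (L + 1) => H) ≃ₗᵢ[ℂ] PiLp 2 (fun _ : Fin (L + 1) => H) :=
  LinearIsometryEquiv.piLpCongrLeft 2 ℂ H (Equiv.addRight (1 : Fin (L + 1))).symm

/-- The cyclic shift, as a bounded operator. -/
def cyclicShiftCLM (H : Type u) [NormedAddCommGroup H] [InnerProductSpace ℂ H] (L : ℕ) :
    PiLp 2 (fun _ : Fin (L + 1) => H) →L[ℂ] PiLp 2 (fun _ : Fin (L + 1) => H) :=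
  (cyclicShift H L).toContinuousLinearEquiv.toContinuousLinearMap

theorem cyclicShiftCLM_mem_unitary (L : ℕ) :
    cyclicShiftCLM H L ∈ unitary (PiLp 2 (fun _ : Fin (L + 1) => H) →L[ℂ] _) :=
  (Unitary.linearIsometryEquiv.symm (cyclicShift H L)).2

omit [CompleteSpace H] in
theorem cyclicShiftCLM_pow_apply (L a : ℕ) (x : PiLp 2 (fun _ : Fin (L + 1) => H))
    (k : Fin (L + 1)) : (cyclicShiftCLM H L ^ a) x k = x (k + a • 1) := by
  induction a generalizing k with
  | zero => simp
  | succ a ih =>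
    rw [pow_succ', succ_nsmul', ← add_assoc]
    exact ih (k + 1)

omit [CompleteSpace H] in
theorem cyclicShiftCLM_pow_card (L : ℕ) : cyclicShiftCLM H L ^ (L + 1) = 1 := by
  ext x k
  have : (L + 1) • (1 : Fin (L + 1)) = 0 := by
    simpa using card_nsmul_eq_zero (G := Fin (L + 1)) (x := 1)
  rw [cyclicShiftCLM_pow_apply, this]
  simp

theorem val_add_nsmul_one {L : ℕ} (k : Fin (L + 1)) {a : ℕ} (h : k.val + a < L + 1) :
    (k + a • 1 : Fin (L + 1)).val = k.val + a := by
  induction a with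
  | zero => simp
  | succ a ih =>
    rw [succ_nsmul, ← add_assoc, Fin.val_add_one_of_lt' (by rw [ih (by omega)]; omega),
      ih (by omega), add_assoc]

/-- The first `m` coordinates carry the orbit of a vector under `N`, damped by the defect
operator `D`; the remaining ones vanish. -/
def orbitMap (N D : H →L[ℂ] H) (m L : ℕ) : H →L[ℂ] PiLp 2 (fun _ : Fin (L + 1) => H) :=
  (PiLp.continuousLinearEquiv 2 ℂ (fun _ : Fin (L + 1) => H)).symm.toContinuousLinearMap ∘L
    ContinuousLinearMap.pi fun k => if k.val < m then D * N ^ k.val else 0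

omit [CompleteSpace H] in
theorem orbitMap_apply (N D : H →L[ℂ] H) (m L : ℕ) (x : H) (k : Fin (L + 1)) :
    orbitMap N D m L x k = if k.val < m then D ((N ^ k.val) x) else 0 := by
  change (if k.val < m then D * N ^ k.val else 0 : H →L[ℂ] H) x = _
  split_ifs <;> rfl

/-- Since `⟪D x, D y⟫ = ⟪x, y⟫ - ⟪N x, N y⟫`, the sum over coordinates telescopes, leaving the first
and last terms. Because `a ≤ d`, the cyclic wrap-around meets only vanishing coordinates. -/
theorem orbitMap_compression {N D : H →L[ℂ] H} (hD : star D * D = 1 - star N * N) {m d a : ℕ}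
    (ha : a ≤ d) (ham : a ≤ m) :
    ContinuousLinearMap.adjoint (orbitMap N D m (m + d)) ∘L
      (cyclicShiftCLM H (m + d) ^ a) ∘L orbitMap N D m (m + d) =
      N ^ a - star (N ^ (m - a)) * N ^ m := by
  have hDi : ∀ x y : H, inner ℂ (D x) (D y) = inner ℂ x y - inner ℂ (N x) (N y) := fun x y => by
    rw [← ContinuousLinearMap.adjoint_inner_right, ← ContinuousLinearMap.adjoint_inner_right N,
      ← inner_sub_right]
    congr 1
    simpa [ContinuousLinearMap.star_eq_adjoint] using DFunLike.congr_fun hD y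
  ext x
  refine ext_inner_left ℂ fun y => ?_
  simp only [ContinuousLinearMap.comp_apply]
  rw [ContinuousLinearMap.adjoint_inner_right, PiLp.inner_apply]
  set g : ℕ → ℂ := fun k =>
    if k < m - a then inner ℂ (D ((N ^ k) y)) (D ((N ^ (k + a)) x)) else 0 with hg
  have hterm : ∀ k : Fin (m + d + 1), inner ℂ (orbitMap N D m (m + d) y k)
      ((cyclicShiftCLM H (m + d) ^ a) (orbitMap N D m (m + d) x) k) = g k := fun k => by
    rw [cyclicShiftCLM_pow_apply, orbitMap_apply, orbitMap_apply, hg]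
    by_cases hk : k.val < m
    · rw [val_add_nsmul_one k (by omega)]
      by_cases hk' : k.val < m - a
      · simp [hk, hk', show k.val + a < m by omega]
      · simp [hk', show ¬ (k.val + a < m) by omega]
    · simp [hk, show ¬ (k.val < m - a) by omega]
  rw [sum_congr rfl fun k _ => hterm k, Fin.sum_univ_eq_sum_range, hg, ← sum_filter,
    show (range (m + d + 1)).filter (fun k => k < m - a) = range (m - a) by
      ext; simp; omega]
  have htel := sum_range_sub' (fun k => inner ℂ ((N ^ k) y) ((N ^ (k + a)) x)) (m - a)
  rw [sum_congr rfl fun k _ => ?_, htel, zero_add, Nat.sub_add_cancel ham]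
  · rw [sub_apply, inner_sub_right, mul_apply_eq_comp, ContinuousLinearMap.star_eq_adjoint,
      ContinuousLinearMap.adjoint_inner_right, pow_zero, one_apply_eq_self]
  · rw [hDi, add_right_comm, pow_succ', pow_succ']
    rfl

/-- For `a = 0` the compression identity reads `W* W = 1 - (N ^ m)* N ^ m ≤ 1`. -/
theorem norm_orbitMap_le_one {N D : H →L[ℂ] H} (hD : star D * D = 1 - star N * N) (m d : ℕ) :
    ‖orbitMap N D m (m + d)‖ ≤ 1 := by
  refine ContinuousLinearMap.opNorm_le_bound _ zero_le_one fun x => ?_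
  have h := orbitMap_compression hD (m := m) (d := d) (Nat.zero_le d) (Nat.zero_le m)
  have h' := congrArg (fun T : H →L[ℂ] H => RCLike.re (inner ℂ x (T x))) h
  simp only [pow_zero, ContinuousLinearMap.comp_apply, Nat.sub_zero, sub_apply,
    one_apply_eq_self, inner_sub_right, mul_apply_eq_comp,
    ContinuousLinearMap.star_eq_adjoint, ContinuousLinearMap.adjoint_inner_right,
    map_sub, inner_self_eq_norm_sq] at h'
  rw [one_mul]
  refine (sq_le_sq₀ (norm_nonneg _) (norm_nonneg _)).1 ?_
  nlinarith [sq_nonneg ‖(N ^ m) x‖]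

theorem exists_defect {N : H →L[ℂ] H} (hN : ‖N‖ ≤ 1) :
    ∃ D : H →L[ℂ] H, star D * D = 1 - star N * N := by
  have h : 0 ≤ 1 - star N * N := by
    rw [sub_nonneg]
    refine CStarAlgebra.norm_le_one_iff_of_nonneg _ |>.1 ?_
    rw [CStarRing.norm_star_mul_self]
    exact mul_le_one₀ hN (norm_nonneg _) hN
  refine ⟨CFC.sqrt (1 - star N * N), ?_⟩
  rw [(CFC.sqrt_nonneg _).isSelfAdjoint.star_eq, CFC.sqrt_mul_sqrt_self _ h]

/-- The expression is the compression by `W` of the divided difference at the cyclic shift, applied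
to `W X W*`; each power of the shift on either side of `X` compresses separately, and `‖W‖ ≤ 1`. -/
theorem CommLipWith.norm_compressed_dividedDiff_le {C : ℝ≥0} {n : ℕ} {a : ℕ → ℂ}
    (h : CommLipWith.{u} C (polyFun unitCircle n a)) {N : H →L[ℂ] H} (hN : ‖N‖ ≤ 1) {m : ℕ}
    (hm : n ≤ m) (X : H →L[ℂ] H) :
    ‖∑ k ∈ range n, a k • ∑ i ∈ range k, (N ^ i - star (N ^ (m - i)) * N ^ m) * X *
      (N ^ (k - 1 - i) - star (N ^ (m - (k - 1 - i))) * N ^ m)‖ ≤ C * ‖X‖ := by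
  obtain ⟨D, hD⟩ := exists_defect hN
  set W := orbitMap N D m (m + n)
  set U := cyclicShiftCLM H (m + n)
  set W' := ContinuousLinearMap.adjoint W
  have hW : ‖W‖ ≤ 1 := norm_orbitMap_le_one hD m n
  have hW' : ‖W'‖ ≤ 1 := by rwa [LinearIsometryEquiv.norm_map]
  have key : ∑ k ∈ range n, a k • ∑ i ∈ range k, (N ^ i - star (N ^ (m - i)) * N ^ m) * X *
      (N ^ (k - 1 - i) - star (N ^ (m - (k - 1 - i))) * N ^ m) =
      W' ∘L dividedDiff n a U U (W ∘L X ∘L W') ∘L W := by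
    ext x
    simp only [dividedDiff, _root_.sum_apply, smul_apply, ContinuousLinearMap.comp_apply, map_sum,
      map_smul, mul_apply_eq_comp]
    refine sum_congr rfl fun k hk => ?_
    congr 1
    refine sum_congr rfl fun i hi => ?_
    have hk := mem_range.1 hk
    have hi := mem_range.1 hi
    rw [← orbitMap_compression hD (d := n) (by omega : i ≤ n) (by omega),
      ← orbitMap_compression hD (d := n) (by omega : k - 1 - i ≤ n) (by omega)]
    rfl
  rw [key]
  have h₁ := h.norm_dividedDiff_periodic_le (cyclicShiftCLM_mem_unitary (m + n))
    (cyclicShiftCLM_pow_card (m + n)) (Nat.succ_ne_zero _) (W ∘L X ∘L W')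
  have h₂ : ‖W ∘L X ∘L W'‖ ≤ ‖X‖ := calc
    _ ≤ ‖W‖ * (‖X‖ * ‖W'‖) := (ContinuousLinearMap.opNorm_comp_le _ _).trans
      (by gcongr; exact ContinuousLinearMap.opNorm_comp_le _ _)
    _ ≤ 1 * (‖X‖ * 1) := by gcongr
    _ = ‖X‖ := by ring
  calc _ ≤ ‖W'‖ * (‖dividedDiff n a U U (W ∘L X ∘L W')‖ * ‖W‖) :=
        (ContinuousLinearMap.opNorm_comp_le _ _).trans
          (by gcongr; exact ContinuousLinearMap.opNorm_comp_le _ _)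
    _ ≤ 1 * ((C * ‖X‖) * 1) := by gcongr; exact h₁.trans (by gcongr)
    _ = C * ‖X‖ := by ring

/-- As `m → ∞` the corrections vanish, since `N ^ m → 0`. -/
theorem CommLipWith.norm_dividedDiff_strict_contraction_le {C : ℝ≥0} {n : ℕ} {a : ℕ → ℂ}
    (h : CommLipWith.{u} C (polyFun unitCircle n a)) {N : H →L[ℂ] H} (hN : ‖N‖ < 1)
    (X : H →L[ℂ] H) : ‖dividedDiff n a N N X‖ ≤ C * ‖X‖ := by
  have hlim : ∀ i : ℕ, Tendsto (fun m : ℕ => N ^ i - star (N ^ (m - i)) * N ^ m) atTop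
      (𝓝 (N ^ i)) := fun i => by
    have h₀ := tendsto_pow_atTop_nhds_zero_of_norm_lt_one hN
    have h₁ : Tendsto (fun m : ℕ => star (N ^ (m - i))) atTop (𝓝 (star 0)) :=
      (continuous_star.tendsto _).comp (h₀.comp (tendsto_sub_atTop_nat i))
    simpa using tendsto_const_nhds.sub (h₁.mul h₀)
  refine le_of_tendsto (Tendsto.norm ?_) ((eventually_ge_atTop n).mono fun m hm =>
    h.norm_compressed_dividedDiff_le hN.le hm X)
  unfold dividedDiff
  refine tendsto_finsetSum _ fun k _ => (tendsto_finsetSum _ fun i _ => ?_).const_smul _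
  exact ((hlim _).mul_const _).mul (hlim _)

theorem CommLipWith.norm_dividedDiff_contraction_le {C : ℝ≥0} {n : ℕ} {a : ℕ → ℂ}
    (h : CommLipWith.{u} C (polyFun unitCircle n a)) {N : H →L[ℂ] H} (hN : ‖N‖ ≤ 1)
    (X : H →L[ℂ] H) : ‖dividedDiff n a N N X‖ ≤ C * ‖X‖ := by
  have hc : Continuous fun t : ℝ => dividedDiff n a ((t : ℂ) • N) ((t : ℂ) • N) X := by
    unfold dividedDiff
    fun_prop
  have hlim : Tendsto (fun t : ℝ => dividedDiff n a ((t : ℂ) • N) ((t : ℂ) • N) X)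
      (𝓝[<] 1) (𝓝 (dividedDiff n a N N X)) := by
    simpa using (hc.tendsto 1).mono_left nhdsWithin_le_nhds
  refine le_of_tendsto hlim.norm ?_
  filter_upwards [Ioo_mem_nhdsLT (zero_lt_one' ℝ)] with t ht
  refine h.norm_dividedDiff_strict_contraction_le ?_ X
  rw [norm_smul, Complex.norm_real, Real.norm_of_nonneg ht.1.le]
  exact (mul_le_of_le_one_right ht.1.le hN).trans_lt ht.2

end

/-- For polynomials, the commutator Lipschitz constants on the circle and on the disc agree. -/
theorem CommLipWith.polyFun_closedDisc {C : ℝ≥0} {n : ℕ} {a : ℕ → ℂ}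
    (h : CommLipWith.{u} C (polyFun unitCircle n a)) :
    CommLipWith.{u} C (polyFun closedDisc n a) := by
  refine commLipWith_iff.2 fun H _ _ _ ψ R => ?_
  rw [map_polyFun, dividedDiff_commutator]
  -- The bound needs only that the image of the coordinate is a contraction.
  refine h.norm_dividedDiff_contraction_le ((NonUnitalStarAlgHom.norm_apply_le ψ _).trans ?_) _
  exact (ContinuousMap.norm_le _ zero_le_one).2 fun z => mem_closedBall_zero_iff.1 z.2

end OpLip

/-! ### From polynomials to the disc algebra -/

namespace OpLip

open Filter Topology Finset
open scoped CStarAlgebra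

/-- The commutator of `ψ g` with `R`, as a continuous linear function of `g`. -/
def commCLM {F : Set ℂ} [CompactSpace F] {H : Type u} [NormedAddCommGroup H]
    [InnerProductSpace ℂ H] [CompleteSpace H] (ψ : C(F, ℂ) →⋆ₐ[ℂ] (H →L[ℂ] H)) (R : H →L[ℂ] H) :
    C(F, ℂ) →L[ℂ] (H →L[ℂ] H) where
  toFun g := ψ g * R - R * ψ g
  map_add' g h := by rw [map_add]; noncomm_ring
  map_smul' c g := by simp [smul_sub]
  cont := by
    have : Continuous ψ := map_continuous ψ
    fun_prop

theorem commCLM_apply {F : Set ℂ} [CompactSpace F] {H : Type u} [NormedAddCommGroup H]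
    [InnerProductSpace ℂ H] [CompleteSpace H] (ψ : C(F, ℂ) →⋆ₐ[ℂ] (H →L[ℂ] H)) (R : H →L[ℂ] H)
    (g : C(F, ℂ)) : commCLM ψ R g = ψ g * R - R * ψ g := rfl

/-- For fixed `ψ` and `R`, the commutator is continuous in the function for the sup norm. -/
theorem commLipWith_of_tendsto {F : Set ℂ} [CompactSpace F] {ι : Type*} {l : Filter ι} [l.NeBot]
    {g : ι → C(F, ℂ)} {f : C(F, ℂ)} {c : ι → ℝ≥0} {C : ℝ≥0} (hg : Tendsto g l (𝓝 f))
    (hc : Tendsto c l (𝓝 C)) (h : ∀ᶠ i in l, CommLipWith.{u} (c i) (g i)) :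
    CommLipWith.{u} C f := by
  refine commLipWith_iff.2 fun H _ _ _ ψ R => ?_
  rw [← commCLM_apply]
  exact le_of_tendsto_of_tendsto (((commCLM ψ R).continuous.tendsto f).comp hg).norm
    (((NNReal.continuous_coe.tendsto C).comp hc).mul_const _)
    (h.mono fun i hi => commLipWith_iff.1 hi H ψ R)

theorem norm_coord_le {F : Set ℂ} [CompactSpace F] (hF : F ⊆ closedDisc) : ‖coord F‖ ≤ 1 :=
  (ContinuousMap.norm_le _ zero_le_one).2 fun z => mem_closedBall_zero_iff.1 (hF z.2)

theorem commLipWith_coord_pow {F : Set ℂ} [CompactSpace F] (hF : F ⊆ closedDisc) (k : ℕ) :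
    CommLipWith.{u} k (coord F ^ k) := by
  refine commLipWith_iff.2 fun H _ _ _ ψ R => ?_
  have hψ : ‖ψ (coord F)‖ ≤ 1 :=
    (NonUnitalStarAlgHom.norm_apply_le ψ _).trans (norm_coord_le hF)
  have hpow : ∀ j, ‖ψ (coord F) ^ j‖ ≤ 1 := fun j => by
    rw [← map_pow]
    refine (NonUnitalStarAlgHom.norm_apply_le ψ _).trans ?_
    refine (ContinuousMap.norm_le _ zero_le_one).2 fun z => ?_
    rw [ContinuousMap.pow_apply, norm_pow]
    exact pow_le_one₀ (norm_nonneg _) (mem_closedBall_zero_iff.1 (hF z.2))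
  rw [map_pow, pow_mul_sub_mul_pow]
  refine (norm_sum_le _ _).trans ((sum_le_card_nsmul _ _ _ fun i _ => ?_).trans_eq
    (by rw [card_range, nsmul_eq_mul]; rfl))
  calc _ ≤ ‖ψ (coord F) ^ i‖ * ‖ψ (coord F) * R - R * ψ (coord F)‖ *
        ‖ψ (coord F) ^ (k - 1 - i)‖ :=
        (norm_mul_le _ _).trans (by gcongr; exact norm_mul_le _ _)
    _ ≤ 1 * ‖ψ (coord F) * R - R * ψ (coord F)‖ * 1 := by gcongr <;> exact hpow _
    _ = _ := by ring

/-- The partial sum differs from `g` by a tail, and `z ^ k` has commutator constant at most `k`. The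
loss tends to `0` as `n → ∞`. -/
theorem CommLipWith.polyFun_of_hasSum {F : Set ℂ} [CompactSpace F] (hF : F ⊆ closedDisc)
    {C : ℝ≥0} {g : C(F, ℂ)} (hg : CommLipWith.{u} C g) {b : ℕ → ℂ}
    (hs : HasSum (fun k => b k • coord F ^ k) g) (hb : Summable fun k => ‖b k‖₊ * (k : ℝ≥0))
    (n : ℕ) :
    CommLipWith.{u} (C + ∑' k, ‖b (k + n)‖₊ * ((k + n : ℕ) : ℝ≥0)) (polyFun F n b) := by
  refine commLipWith_iff.2 fun H _ _ _ ψ R => ?_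
  set B := ‖ψ (coord F) * R - R * ψ (coord F)‖
  have h₁ := ((hasSum_nat_add_iff' n).2 hs).mapL (commCLM ψ R)
  have h₂ : HasSum (fun k => ((‖b (k + n)‖₊ * ((k + n : ℕ) : ℝ≥0) : ℝ≥0) : ℝ) * B)
      ((∑' k, ‖b (k + n)‖₊ * ((k + n : ℕ) : ℝ≥0) : ℝ≥0) * B) :=
    (NNReal.hasSum_coe.2 ((NNReal.summable_nat_add _ hb n).hasSum)).mul_right _
  have h₃ := h₁.norm_le_of_bounded h₂ fun k => by
    rw [map_smul, norm_smul, NNReal.coe_mul, mul_assoc, coe_nnnorm]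
    gcongr
    exact commLipWith_iff.1 (commLipWith_coord_pow hF (k + n)) H ψ R
  have h₄ := commLipWith_iff.1 hg H ψ R
  rw [← commCLM_apply] at h₄ ⊢
  rw [NNReal.coe_add, add_mul]
  have h₅ : commCLM ψ R (polyFun F n b) = commCLM ψ R g - commCLM ψ R (g - polyFun F n b) := by
    rw [← map_sub, sub_sub_cancel]
  rw [h₅]
  exact (norm_sub_le _ _).trans (add_le_add h₄ h₃)

/-- Multiplication by a point of the closed disc. -/
def scale : C(closedDisc, C(closedDisc, closedDisc)) :=
  ContinuousMap.curry
    ⟨fun p : closedDisc × closedDisc => ⟨p.1.1 * p.2.1, by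
        have h₁ := mem_closedBall_zero_iff.1 p.1.2
        have h₂ := mem_closedBall_zero_iff.1 p.2.2
        rw [mem_closedBall_zero_iff, norm_mul]
        exact mul_le_one₀ h₁ (norm_nonneg _) h₂⟩, by fun_prop⟩

theorem coe_scale (w z : closedDisc) : (scale w z : ℂ) = w * z := rfl

theorem continuous_comp_scale (f : C(closedDisc, ℂ)) : Continuous fun w => f.comp (scale w) :=
  (ContinuousMap.continuous_postcomp f).comp scale.continuous

theorem continuous_toCircle : Continuous toCircle :=
  ContinuousMap.continuous_precomp _

/-- Rotating the circle multiplies the coordinate by a unimodular constant. -/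
theorem CommLipWith.toCircle_comp_scale {C : ℝ≥0} {f : C(closedDisc, ℂ)}
    (hf : CommLipWith.{u} C (toCircle f)) {ζ : closedDisc} (hζ : ‖(ζ : ℂ)‖ = 1) :
    CommLipWith.{u} C (toCircle (f.comp (scale ζ))) := by
  refine commLipWith_iff.2 fun H _ _ _ ψ R => ?_
  let rot : C(unitCircle, unitCircle) :=
    ⟨fun z => ⟨ζ * z, by
      rw [mem_sphere_zero_iff_norm, norm_mul, hζ, mem_sphere_zero_iff_norm.1 z.2, mul_one]⟩,
      by fun_prop⟩
  have h := commLipWith_iff.1 hf H (ψ.comp (ContinuousMap.compStarAlgHom' ℂ ℂ rot)) R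
  have h₁ : ContinuousMap.compStarAlgHom' ℂ ℂ rot (coord unitCircle) =
      (ζ : ℂ) • coord unitCircle := rfl
  have h₂ : ContinuousMap.compStarAlgHom' ℂ ℂ rot (toCircle f) =
      toCircle (f.comp (scale ζ)) := rfl
  rwa [StarAlgHom.comp_apply, StarAlgHom.comp_apply, h₁, h₂, map_smul, smul_mul_assoc,
    mul_smul_comm, ← smul_sub, norm_smul, hζ, one_mul] at h

/-- The extension by zero of a function in the disc algebra. -/
def ext₀ (f : C(closedDisc, ℂ)) : ℂ → ℂ := Function.extend Subtype.val f 0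

theorem ext₀_apply (f : C(closedDisc, ℂ)) (z : closedDisc) : ext₀ f z = f z :=
  Subtype.val_injective.extend_apply _ _ _

theorem continuousOn_ext₀ (f : C(closedDisc, ℂ)) : ContinuousOn (ext₀ f) closedDisc := by
  rw [continuousOn_iff_continuous_domRestrict]
  convert f.continuous using 1
  ext z
  exact ext₀_apply f z

theorem diffContOnCl_ext₀ {f : C(closedDisc, ℂ)} (hf : f ∈ discAlgebra) :
    DiffContOnCl ℂ (ext₀ f) (Metric.ball 0 1) :=
  ⟨AnalyticOnNhd.differentiableOn hf, by
    rw [closure_ball _ one_ne_zero]; exact continuousOn_ext₀ f⟩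

/-- The point `e ^ (iθ)` of the closed disc. -/
def circlePoint (θ : ℝ) : closedDisc :=
  ⟨circleMap 0 1 θ, Metric.sphere_subset_closedBall (circleMap_mem_sphere 0 zero_le_one θ)⟩

theorem continuous_circlePoint : Continuous circlePoint := by
  unfold circlePoint
  have := continuous_circleMap 0 1
  fun_prop

theorem norm_circlePoint (θ : ℝ) : ‖(circlePoint θ : ℂ)‖ = 1 := by
  simp [circlePoint]

theorem continuous_poissonKernel {w : closedDisc} (hw : ‖(w : ℂ)‖ < 1) :
    Continuous fun θ => poissonKernel 0 w (circleMap 0 1 θ) := by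
  have := continuous_circleMap 0 1
  unfold poissonKernel
  refine Continuous.div (by fun_prop) (by fun_prop) fun θ => ?_
  refine pow_ne_zero _ (norm_ne_zero_iff.2 (sub_ne_zero.2 fun h => ?_))
  have h' := congrArg norm h
  simp only [sub_zero, norm_circleMap_zero, abs_one] at h'
  exact hw.ne h'.symm

theorem poissonKernel_nonneg {w : closedDisc} (hw : ‖(w : ℂ)‖ < 1) (θ : ℝ) :
    0 ≤ poissonKernel 0 w (circleMap 0 1 θ) := by
  unfold poissonKernel
  refine div_nonneg ?_ (sq_nonneg _)
  simp only [sub_zero, norm_circleMap_zero, abs_one]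
  nlinarith [norm_nonneg (w : ℂ)]

/-- For each `z`, this is the Poisson formula for `x ↦ f (x z)` at `w`. Read in `C(unitCircle, ℂ)`,
it makes the dilate an average of rotations of `f`. -/
theorem toCircle_comp_scale_eq_integral {f : C(closedDisc, ℂ)} (hf : f ∈ discAlgebra)
    {w : closedDisc} (hw : ‖(w : ℂ)‖ < 1) :
    toCircle (f.comp (scale w)) = (2 * Real.pi)⁻¹ • ∫ θ in 0..2 * Real.pi,
      poissonKernel 0 w (circleMap 0 1 θ) • toCircle (f.comp (scale (circlePoint θ))) := by
  have hc : Continuous fun θ =>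
      poissonKernel 0 w (circleMap 0 1 θ) • toCircle (f.comp (scale (circlePoint θ))) :=
    (continuous_poissonKernel hw).smul
      (continuous_toCircle.comp ((continuous_comp_scale f).comp continuous_circlePoint))
  ext z
  have hz : ‖(z : ℂ)‖ = 1 := mem_sphere_zero_iff_norm.1 z.2
  set z' : closedDisc := ⟨z, Metric.sphere_subset_closedBall z.2⟩
  have hmaps : Set.MapsTo (fun x : ℂ => x * z) (Metric.ball 0 1) (Metric.ball 0 1) :=
    fun x hx => by simpa [hz] using hx
  have hd : DiffContOnCl ℂ (fun x => ext₀ f (x * z)) (Metric.ball 0 1) :=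
    (diffContOnCl_ext₀ hf).comp
      (DifferentiableOn.diffContOnCl (by fun_prop)) hmaps
  have hP := hd.circleAverage_poissonKernel_smul (w := w) (mem_ball_zero_iff.2 hw)
  have hL := (ContinuousMap.evalCLM ℝ z (M := ℂ)).intervalIntegral_comp_comm
    (hc.intervalIntegrable (μ := MeasureTheory.volume) 0 (2 * Real.pi))
  rw [ContinuousMap.smul_apply]
  have hE : ∀ g : C(unitCircle, ℂ), g z = ContinuousMap.evalCLM ℝ z (M := ℂ) g := fun _ => rfl
  rw [hE (∫ θ in _.._, _), ← hL]
  change f (scale w z') = _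
  rw [← ext₀_apply, coe_scale]
  refine hP.symm.trans ?_
  rw [Real.circleAverage_def]
  congr 1
  refine intervalIntegral.integral_congr fun θ _ => ?_
  change poissonKernel 0 w (circleMap 0 1 θ) • ext₀ f (circleMap 0 1 θ * z) =
    poissonKernel 0 w (circleMap 0 1 θ) • f (scale (circlePoint θ) z')
  rw [← ext₀_apply f (scale (circlePoint θ) z')]
  rfl

theorem integral_poissonKernel {w : closedDisc} (hw : ‖(w : ℂ)‖ < 1) :
    (2 * Real.pi)⁻¹ * ∫ θ in 0..2 * Real.pi, poissonKernel 0 w (circleMap 0 1 θ) = 1 := by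
  have h := (diffContOnCl_const (c := (1 : ℂ)) (s := Metric.ball (0 : ℂ) 1) (𝕜 := ℂ)
    (E := ℂ)).circleAverage_poissonKernel_smul (w := w) (mem_ball_zero_iff.2 hw)
  rw [Real.circleAverage_def] at h
  simp only [Pi.smul_apply', Complex.real_smul, mul_one] at h
  rw [intervalIntegral.integral_ofReal] at h
  exact_mod_cast h

/-- The Poisson kernel is a probability density, so averaging the rotations keeps the constant `C`.
-/
theorem CommLipWith.toCircle_comp_scale_of_lt {C : ℝ≥0} {f : C(closedDisc, ℂ)}
    (hfA : f ∈ discAlgebra) (hf : CommLipWith.{u} C (toCircle f)) {w : closedDisc}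
    (hw : ‖(w : ℂ)‖ < 1) : CommLipWith.{u} C (toCircle (f.comp (scale w))) := by
  refine commLipWith_iff.2 fun H _ _ _ ψ R => ?_
  set B := ‖ψ (coord unitCircle) * R - R * ψ (coord unitCircle)‖
  have hq := continuous_poissonKernel hw
  have hc : Continuous fun θ =>
      poissonKernel 0 w (circleMap 0 1 θ) • toCircle (f.comp (scale (circlePoint θ))) :=
    hq.smul (continuous_toCircle.comp ((continuous_comp_scale f).comp continuous_circlePoint))
  have hL := (commCLM ψ R).intervalIntegral_comp_comm
    (hc.intervalIntegrable (μ := MeasureTheory.volume) 0 (2 * Real.pi))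
  have hpi : (0 : ℝ) ≤ 2 * Real.pi := by positivity
  rw [toCircle_comp_scale_eq_integral hfA hw, ← commCLM_apply,
    ContinuousLinearMap.map_smul_of_tower, ← hL, norm_smul,
    Real.norm_of_nonneg (by positivity)]
  calc _ ≤ (2 * Real.pi)⁻¹ * ∫ θ in 0..2 * Real.pi,
        poissonKernel 0 w (circleMap 0 1 θ) * (C * B) := by
        gcongr
        refine intervalIntegral.norm_integral_le_of_norm_le hpi
          (Eventually.of_forall fun θ _ => ?_)
          ((hq.mul continuous_const).intervalIntegrable _ _)
        rw [ContinuousLinearMap.map_smul_of_tower, norm_smul,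
          Real.norm_of_nonneg (poissonKernel_nonneg hw θ)]
        gcongr
        · exact poissonKernel_nonneg hw θ
        · exact commLipWith_iff.1 (hf.toCircle_comp_scale (norm_circlePoint θ)) H ψ R
    _ = C * B := by
        rw [intervalIntegral.integral_mul_const, ← mul_assoc, integral_poissonKernel hw, one_mul]

theorem exists_hasSum_ext₀ {f : C(closedDisc, ℂ)} (hf : f ∈ discAlgebra) :
    ∃ a : ℕ → ℂ, ∀ z : ℂ, ‖z‖ < 1 → HasSum (fun k => a k * z ^ k) (ext₀ f z) := by
  refine ⟨fun k => (k.factorial : ℂ)⁻¹ * iteratedDeriv k (ext₀ f) 0, fun z hz => ?_⟩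
  have h := Complex.hasSum_taylorSeries_on_ball (diffContOnCl_ext₀ hf).differentiableOn
    (mem_ball_zero_iff.2 hz)
  refine h.congr_fun fun k => ?_
  simp only [smul_eq_mul, sub_zero]
  ring

theorem hasSum_comp_scale {f : C(closedDisc, ℂ)} {a : ℕ → ℂ}
    (hT : ∀ z : ℂ, ‖z‖ < 1 → HasSum (fun k => a k * z ^ k) (ext₀ f z))
    {w : closedDisc} (hw : ‖(w : ℂ)‖ < 1) (ha : Summable fun k => ‖a k * (w : ℂ) ^ k‖) :
    HasSum (fun k => (a k * (w : ℂ) ^ k) • coord closedDisc ^ k) (f.comp (scale w)) := by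
  have hS : Summable fun k => (a k * (w : ℂ) ^ k) • coord closedDisc ^ k := by
    refine Summable.of_norm_bounded ha fun k => ?_
    rw [norm_smul]
    refine mul_le_of_le_one_right (norm_nonneg _) ?_
    exact (norm_pow_le _ _).trans (pow_le_one₀ (norm_nonneg _) (norm_coord_le subset_rfl))
  have hE : ∑' k, (a k * (w : ℂ) ^ k) • coord closedDisc ^ k = f.comp (scale w) := by
    ext z
    refine (ContinuousMap.hasSum_apply hS.hasSum z).unique ?_
    rw [ContinuousMap.comp_apply, ← ext₀_apply, coe_scale]
    have hz := mem_closedBall_zero_iff.1 z.2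
    have hwz : ‖(w * z : ℂ)‖ < 1 := by
      rw [norm_mul]
      exact (mul_le_of_le_one_right (norm_nonneg _) hz).trans_lt hw
    refine (hT (w * z) hwz).congr_fun fun k => ?_
    rw [mul_pow, ← mul_assoc]
    rfl
  exact hE ▸ hS.hasSum

/-- Convergence at some `ρ` between `‖w‖` and `1` bounds `a k * ρ ^ k`, so `a k * w ^ k` decays
geometrically and survives the factor `k`. -/
theorem exists_hasSum_comp_scale {f : C(closedDisc, ℂ)} (hf : f ∈ discAlgebra)
    {w : closedDisc} (hw : ‖(w : ℂ)‖ < 1) :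
    ∃ b : ℕ → ℂ, (Summable fun k => ‖b k‖₊ * (k : ℝ≥0)) ∧
      HasSum (fun k => b k • coord closedDisc ^ k) (f.comp (scale w)) := by
  obtain ⟨ρ, hwρ, hρ⟩ := exists_between hw
  have hρ0 : 0 < ρ := (norm_nonneg _).trans_lt hwρ
  obtain ⟨a, hT⟩ := exists_hasSum_ext₀ hf
  obtain ⟨M, hM⟩ : ∃ M, ∀ k, ‖a k * (ρ : ℂ) ^ k‖ ≤ M := by
    have h := (hT ρ (by rwa [Complex.norm_real, Real.norm_of_nonneg hρ0.le])).summable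
    obtain ⟨M, hM⟩ := h.tendsto_atTop_zero.norm.bddAbove_range
    exact ⟨M, fun k => hM ⟨k, rfl⟩⟩
  have ht0 : 0 ≤ ‖(w : ℂ)‖ / ρ := by positivity
  have ht1 : ‖(w : ℂ)‖ / ρ < 1 := (div_lt_one hρ0).2 hwρ
  have hb : ∀ k, ‖a k * (w : ℂ) ^ k‖ ≤ M * (‖(w : ℂ)‖ / ρ) ^ k := fun k => by
    have := hM k
    rw [norm_mul, norm_pow, Complex.norm_real, Real.norm_of_nonneg hρ0.le] at this
    rw [norm_mul, norm_pow, div_pow, mul_div_assoc', le_div_iff₀ (by positivity), mul_right_comm]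
    exact mul_le_mul_of_nonneg_right this (by positivity)
  have htn : ‖‖(w : ℂ)‖ / ρ‖ < 1 := by rwa [Real.norm_of_nonneg ht0]
  generalize ‖(w : ℂ)‖ / ρ = t at *
  have hsum : ∀ j : ℕ, Summable fun k : ℕ => M * ((k : ℝ) ^ j * t ^ k) := fun j =>
    (summable_pow_mul_geometric_of_norm_lt_one j htn).mul_left M
  refine ⟨fun k => a k * (w : ℂ) ^ k, ?_, hasSum_comp_scale hT hw ?_⟩
  · rw [← NNReal.summable_coe]
    refine (hsum 1).of_nonneg_of_le (fun k => NNReal.coe_nonneg _) fun k => ?_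
    rw [NNReal.coe_mul, coe_nnnorm, NNReal.coe_natCast, pow_one, mul_left_comm, mul_comm]
    exact mul_le_mul_of_nonneg_left (hb k) (Nat.cast_nonneg k)
  · refine (hsum 0).of_nonneg_of_le (fun k => norm_nonneg _) fun k => ?_
    rw [pow_zero, one_mul]
    exact hb k

/-- The Taylor polynomials of the dilate have circle constants at most `C` plus a vanishing tail;
these pass to the disc, and then to the limit. -/
theorem CommLipWith.comp_scale {C : ℝ≥0} {f : C(closedDisc, ℂ)}
    (hfA : f ∈ discAlgebra) (hf : CommLipWith.{u} C (toCircle f)) {w : closedDisc}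
    (hw : ‖(w : ℂ)‖ < 1) : CommLipWith.{u} C (f.comp (scale w)) := by
  obtain ⟨b, hb, hs⟩ := exists_hasSum_comp_scale hfA hw
  have hs' : HasSum (fun k => b k • coord unitCircle ^ k) (toCircle (f.comp (scale w))) :=
    hs.map toCircle continuous_toCircle
  have hlim : Tendsto (fun n => C + ∑' k, ‖b (k + n)‖₊ * ((k + n : ℕ) : ℝ≥0)) atTop (𝓝 C) := by
    simpa using (NNReal.tendsto_sum_nat_add fun k => ‖b k‖₊ * (k : ℝ≥0)).const_add C
  exact commLipWith_of_tendsto hs.tendsto_sum_nat hlim (Eventually.of_forall fun n =>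
    ((hf.toCircle_comp_scale_of_lt hfA hw).polyFun_of_hasSum
      Metric.sphere_subset_closedBall hs' hb n).polyFun_closedDisc)

/-- In the disc algebra, a commutator Lipschitz bound on the circle extends to the disc. -/
theorem CommLipWith.of_toCircle {C : ℝ≥0} {f : C(closedDisc, ℂ)} (hfA : f ∈ discAlgebra)
    (hf : CommLipWith.{u} C (toCircle f)) : CommLipWith.{u} C f := by
  set w : ℕ → closedDisc := fun n => ⟨((1 - 1 / ((n : ℝ) + 1) : ℝ) : ℂ), by
    have h : 1 / ((n : ℝ) + 1) ≤ 1 := by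
      rw [div_le_one (by positivity)]; linarith [Nat.cast_nonneg (α := ℝ) n]
    have h' : 0 ≤ 1 / ((n : ℝ) + 1) := by positivity
    rw [mem_closedBall_zero_iff, Complex.norm_real, Real.norm_of_nonneg (by linarith)]
    linarith⟩ with hw
  have hw1 : ∀ n, ‖(w n : ℂ)‖ < 1 := fun n => by
    have h : 1 / ((n : ℝ) + 1) ≤ 1 := by
      rw [div_le_one (by positivity)]; linarith [Nat.cast_nonneg (α := ℝ) n]
    have h' : 0 < 1 / ((n : ℝ) + 1) := by positivity
    rw [Complex.norm_real, Real.norm_of_nonneg (by linarith)]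
    linarith
  have hlim : Tendsto w atTop (𝓝 ⟨1, by simp⟩) := by
    rw [tendsto_subtype_rng]
    have := (tendsto_one_div_add_atTop_nhds_zero_nat (𝕜 := ℝ)).const_sub 1
    rw [sub_zero] at this
    exact (Complex.continuous_ofReal.tendsto _).comp this
  have h := ((continuous_comp_scale f).tendsto _).comp hlim
  have h1 : f.comp (scale ⟨1, by simp⟩) = f := by
    ext z
    rw [ContinuousMap.comp_apply]
    congr 1
    exact Subtype.ext (one_mul _)
  rw [h1] at h
  exact commLipWith_of_tendsto h tendsto_const_nhds
    (Eventually.of_forall fun n => hf.comp_scale hfA (hw1 n))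

end OpLip

/-! ### The Hilbert matrix and Schur multipliers -/

namespace OpLip

open Filter Topology Finset Complex

section Hilbert

variable {ι : Type*} [Fintype ι]

theorem integral_exp_int_mul (n : ℤ) :
    ∫ t in (0 : ℝ)..2 * Real.pi, exp (n * t * I) = if n = 0 then (2 * Real.pi : ℂ) else (0 : ℂ) := by
  split_ifs with h
  · simp [h]
  · have hc : (n * I : ℂ) ≠ 0 := by simp [h]
    have := integral_exp_mul_complex (a := 0) (b := 2 * Real.pi) hc
    simp only [mul_right_comm _ I] at this
    rw [this]
    have h2 : exp (n * ((2 * Real.pi : ℝ) : ℂ) * I) = 1 := by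
      rw [← exp_int_mul_two_pi_mul_I n]
      push_cast
      ring_nf
    rw [h2]
    simp

/-- These integrals exhibit the Hilbert matrix as a Toeplitz matrix with bounded symbol `π - t`. For
`n = 0` the convention `I / 0 = 0` agrees with the mean of the symbol. -/
theorem integral_pi_sub_mul_exp (n : ℤ) :
    ∫ t in (0 : ℝ)..2 * Real.pi, (Real.pi - t : ℂ) * exp (n * t * I) =
      2 * Real.pi * (I / n) := by
  rcases eq_or_ne n 0 with rfl | h
  · have h1 : ∫ t in (0 : ℝ)..2 * Real.pi, (Real.pi - t) = 0 := by
      rw [intervalIntegral.integral_sub (by simp) (by simp)]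
      simp
      ring
    have h2 : ∫ t in (0 : ℝ)..2 * Real.pi, ((Real.pi - t : ℝ) : ℂ) = 0 := by
      rw [intervalIntegral.integral_ofReal, h1, ofReal_zero]
    simpa using h2
  · have hn : (n : ℂ) ≠ 0 := by simp [h]
    have hd : ∀ t : ℝ, HasDerivAt (fun t : ℝ => (Real.pi - t : ℂ) * exp (n * t * I) / (n * I) +
        exp (n * t * I) / (n * I) ^ 2) ((Real.pi - t : ℂ) * exp (n * t * I)) t := fun t => by
      have h0 : HasDerivAt (fun t : ℝ => (t : ℂ)) 1 t := ofRealCLM.hasDerivAt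
      have h1 : HasDerivAt (fun t : ℝ => exp (n * t * I)) (exp (n * t * I) * (n * 1 * I)) t :=
        ((h0.const_mul (n : ℂ)).mul_const I).cexp
      refine ((((h0.const_sub (Real.pi : ℂ)).mul h1).div_const (n * I)).add
        (h1.div_const ((n * I) ^ 2))).congr_deriv ?_
      field_simp
      ring
    rw [intervalIntegral.integral_eq_sub_of_hasDerivAt (fun t _ => hd t)
      (Continuous.intervalIntegrable (by fun_prop) _ _)]
    have h2 : exp (n * ((2 * Real.pi : ℝ) : ℂ) * I) = 1 := by
      rw [← exp_int_mul_two_pi_mul_I n]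
      push_cast
      ring_nf
    rw [h2]
    simp only [ofReal_zero, mul_zero, zero_mul, exp_zero]
    push_cast
    field_simp
    rw [I_pow_three]
    ring

/-- The trigonometric polynomial with coefficients `x i` at the frequencies `v i`. -/
def trigPoly (v : ι → ℤ) (x : ι → ℂ) (t : ℝ) : ℂ := ∑ i, x i * exp (v i * t * I)

theorem continuous_trigPoly (v : ι → ℤ) (x : ι → ℂ) : Continuous (trigPoly v x) := by
  unfold trigPoly
  fun_prop

theorem integral_mul_trigPoly (v : ι → ℤ) (x y : ι → ℂ) {g : ℝ → ℂ} (hg : Continuous g) :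
    ∫ t in (0 : ℝ)..2 * Real.pi, g t * (star (trigPoly v y t) * trigPoly v x t) =
      ∑ j, ∑ k, star (y j) * x k *
        ∫ t in (0 : ℝ)..2 * Real.pi, g t * exp ((v k - v j : ℤ) * t * I) := by
  have h : ∀ t, g t * (star (trigPoly v y t) * trigPoly v x t) =
      ∑ j, ∑ k, star (y j) * x k * (g t * exp ((v k - v j : ℤ) * t * I)) := fun t => by
    rw [trigPoly, trigPoly, star_sum, sum_mul_sum, mul_sum]
    refine sum_congr rfl fun j _ => ?_
    rw [mul_sum]
    refine sum_congr rfl fun k _ => ?_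
    have : star (exp (v j * t * I)) = exp (-(v j * t * I)) := by
      change (starRingEnd ℂ) _ = _
      rw [← exp_conj]
      simp
    rw [star_mul', this, show (((v k - v j : ℤ) : ℂ) * t * I) = -(v j * t * I) + v k * t * I by
      push_cast; ring, exp_add]
    ring
  simp only [h]
  rw [intervalIntegral.integral_finsetSum fun j _ =>
    Continuous.intervalIntegrable (by fun_prop) _ _]
  refine sum_congr rfl fun j _ => ?_
  rw [intervalIntegral.integral_finsetSum fun k _ =>
    Continuous.intervalIntegrable (by fun_prop) _ _]
  refine sum_congr rfl fun k _ => ?_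
  rw [intervalIntegral.integral_const_mul]

theorem integral_norm_trigPoly_sq {v : ι → ℤ} (hv : Function.Injective v) (x : ι → ℂ) :
    ∫ t in (0 : ℝ)..2 * Real.pi, ‖trigPoly v x t‖ ^ 2 = 2 * Real.pi * ∑ i, ‖x i‖ ^ 2 := by
  classical
  have h := integral_mul_trigPoly v x x (g := fun _ => 1) continuous_const
  have h1 : ∀ z : ℂ, star z * z = ((‖z‖ ^ 2 : ℝ) : ℂ) := fun z => by
    rw [ofReal_pow]; exact conj_mul' z
  simp only [one_mul, integral_exp_int_mul, sub_eq_zero, hv.eq_iff, h1, mul_ite, mul_zero,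
    sum_ite_eq', mem_univ, if_true] at h
  rw [intervalIntegral.integral_ofReal] at h
  apply ofReal_injective
  rw [h, ← sum_mul]
  push_cast
  ring

variable [DecidableEq ι]

/-- The Hilbert matrix `I / (v k - v j)`, with zero diagonal. -/
def hilbertMatrix (v : ι → ℤ) : Matrix ι ι ℂ := Matrix.of fun j k => I / ((v k - v j : ℤ) : ℂ)

omit [Fintype ι] [DecidableEq ι] in
theorem norm_hilbertMatrix_apply_le (v : ι → ℤ) (j k : ι) : ‖hilbertMatrix v j k‖ ≤ 1 := by
  rw [hilbertMatrix, Matrix.of_apply, norm_div, norm_I, norm_intCast]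
  rcases eq_or_ne (v k - v j) 0 with h | h
  · simp [h]
  · rw [div_le_one (by positivity)]
    exact_mod_cast Int.one_le_abs h

theorem inner_toEuclideanCLM_apply (M : Matrix ι ι ℂ) (x y : EuclideanSpace ℂ ι) :
    inner ℂ y (Matrix.toEuclideanCLM (𝕜 := ℂ) M x) = ∑ j, ∑ k, star (y j) * x k * M j k := by
  rw [PiLp.inner_apply]
  refine sum_congr rfl fun j _ => ?_
  rw [Matrix.ofLp_toEuclideanCLM, RCLike.inner_apply, Matrix.mulVec, dotProduct, sum_mul]
  refine sum_congr rfl fun k _ => ?_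
  change _ * star (y j) = _
  ring

/-- The sesquilinear form is the mean of `(π - t) * star Q * P` over a period; `|π - t| ≤ π` there,
and Parseval evaluates the squares. -/
theorem norm_hilbertMatrix_le {v : ι → ℤ} (hv : Function.Injective v) :
    ‖Matrix.toEuclideanCLM (𝕜 := ℂ) (hilbertMatrix v)‖ ≤ Real.pi := by
  refine ContinuousLinearMap.opNorm_le_of_re_inner_le Real.pi_pos.le fun x y hx hy => ?_
  rw [← inner_conj_symm, RCLike.conj_re]
  refine (RCLike.re_le_norm _).trans ?_
  have hpi := Real.pi_pos
  set P := trigPoly v x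
  set Q := trigPoly v y
  have hP : Continuous P := continuous_trigPoly v x
  have hQ : Continuous Q := continuous_trigPoly v y
  have h : 2 * Real.pi * inner ℂ y (Matrix.toEuclideanCLM (𝕜 := ℂ) (hilbertMatrix v) x) =
      ∫ t in (0 : ℝ)..2 * Real.pi, (Real.pi - t : ℂ) * (star (Q t) * P t) := by
    rw [integral_mul_trigPoly v x y (g := fun t : ℝ => (Real.pi - t : ℂ)) (by fun_prop),
      inner_toEuclideanCLM_apply, mul_sum]
    refine sum_congr rfl fun j _ => ?_
    rw [mul_sum]
    refine sum_congr rfl fun k _ => ?_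
    rw [integral_pi_sub_mul_exp, hilbertMatrix, Matrix.of_apply]
    ring
  have hb : ‖∫ t in (0 : ℝ)..2 * Real.pi, (Real.pi - t : ℂ) * (star (Q t) * P t)‖ ≤
      ∫ t in (0 : ℝ)..2 * Real.pi, Real.pi * ((‖Q t‖ ^ 2 + ‖P t‖ ^ 2) / 2) := by
    refine intervalIntegral.norm_integral_le_of_norm_le (by positivity)
      (Eventually.of_forall fun t ht => ?_) (Continuous.intervalIntegrable (by fun_prop) _ _)
    rw [norm_mul, norm_mul, norm_star]
    have h1 : ‖(Real.pi - t : ℂ)‖ ≤ Real.pi := by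
      rw [← ofReal_sub, norm_real, Real.norm_eq_abs, abs_le]
      constructor <;> linarith [ht.1, ht.2]
    gcongr
    nlinarith [sq_nonneg (‖Q t‖ - ‖P t‖)]
  have hn : ∀ x : EuclideanSpace ℂ ι, ‖x‖ = 1 → ∑ i, ‖x i‖ ^ 2 = 1 := fun x hx => by
    rw [← EuclideanSpace.norm_sq_eq, hx, one_pow]
  have hI : ∫ t in (0 : ℝ)..2 * Real.pi, Real.pi * ((‖Q t‖ ^ 2 + ‖P t‖ ^ 2) / 2) =
      2 * Real.pi * Real.pi := by
    rw [intervalIntegral.integral_const_mul, intervalIntegral.integral_div,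
      intervalIntegral.integral_add (Continuous.intervalIntegrable (by fun_prop) _ _)
        (Continuous.intervalIntegrable (by fun_prop) _ _),
      integral_norm_trigPoly_sq hv, integral_norm_trigPoly_sq hv, hn x hx, hn y hy]
    ring
  rw [← h, hI, norm_mul, ← ofReal_ofNat, ← ofReal_mul, norm_real,
    Real.norm_of_nonneg (by positivity)] at hb
  exact le_of_mul_le_mul_left hb (by positivity)

/-- Pair with the all-ones vector, whose squared norm is the cardinality. -/
theorem norm_sum_entries_le (M : Matrix ι ι ℂ) :
    ‖∑ j, ∑ k, M j k‖ ≤ Fintype.card ι * ‖Matrix.toEuclideanCLM (𝕜 := ℂ) M‖ := by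
  set e : EuclideanSpace ℂ ι := WithLp.toLp 2 fun _ => 1
  have he : ‖e‖ ^ 2 = Fintype.card ι := by simp [e, EuclideanSpace.norm_sq_eq]
  have h := inner_toEuclideanCLM_apply M e e
  simp only [e, star_one, one_mul] at h
  rw [← h, ← he, sq, mul_assoc, mul_comm ‖e‖ ‖_‖]
  exact (norm_inner_le_norm _ _).trans
    (mul_le_mul_of_nonneg_left (ContinuousLinearMap.le_opNorm _ _) (norm_nonneg _))

/-- The representation of `C(F, ℂ)` by diagonal matrices given by points of `F`. -/
def diagRep {F : Set ℂ} (z : ι → F) :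
    C(F, ℂ) →⋆ₐ[ℂ] (EuclideanSpace ℂ ι →L[ℂ] EuclideanSpace ℂ ι) where
  toFun g := Matrix.toEuclideanCLM (𝕜 := ℂ) (Matrix.diagonal fun i => g (z i))
  map_one' := by simp
  map_mul' f g := by simp [← map_mul, Matrix.diagonal_mul_diagonal]
  map_zero' := by simp
  map_add' f g := by simp [← map_add, Matrix.diagonal_add]
  commutes' c := by
    have h : (Matrix.diagonal fun _ : ι => c) = algebraMap ℂ (Matrix ι ι ℂ) c :=
      (Matrix.algebraMap_eq_diagonal c).symm
    exact (congrArg _ h).trans (AlgHomClass.commutes _ c)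
  map_star' f := by
    rw [← map_star, Matrix.star_eq_conjTranspose, Matrix.diagonal_conjTranspose]
    rfl

end Hilbert

/-- A commutator Lipschitz bound makes the matrices of difference quotients bounded Schur
multipliers. -/
theorem CommLipWith.norm_schur_le {F : Set ℂ} [CompactSpace F] {C : ℝ≥0} {f : C(F, ℂ)}
    (hf : CommLipWith.{u} C f) {ι : Type u} [Fintype ι] [DecidableEq ι] (z w : ι → F)
    (hzw : ∀ j k, (z j : ℂ) ≠ w k) (X : Matrix ι ι ℂ) :
    ‖Matrix.toEuclideanCLM (𝕜 := ℂ)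
      (Matrix.of fun j k => (f (z j) - f (w k)) / (z j - w k) * X j k)‖ ≤
      C * ‖Matrix.toEuclideanCLM (𝕜 := ℂ) X‖ := by
  -- The solution of `diag(z) R - R diag(w) = X`.
  set R : Matrix ι ι ℂ := Matrix.of fun j k => X j k / (z j - w k)
  have key : ∀ g : C(F, ℂ), diagRep z g * Matrix.toEuclideanCLM (𝕜 := ℂ) R -
      Matrix.toEuclideanCLM (𝕜 := ℂ) R * diagRep w g = Matrix.toEuclideanCLM (𝕜 := ℂ)
        (Matrix.of fun j k => (g (z j) - g (w k)) / (z j - w k) * X j k) := fun g => by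
    change Matrix.toEuclideanCLM (𝕜 := ℂ) (Matrix.diagonal fun i => g (z i)) * _ -
      _ * Matrix.toEuclideanCLM (𝕜 := ℂ) (Matrix.diagonal fun i => g (w i)) = _
    rw [← map_mul, ← map_mul, ← map_sub]
    congr 1
    ext j k
    simp only [Matrix.sub_apply, Matrix.diagonal_mul, Matrix.mul_diagonal, Matrix.of_apply, R]
    ring
  have h := hf.norm_mul_sub_mul_le (diagRep z) (diagRep w) (Matrix.toEuclideanCLM (𝕜 := ℂ) R)
  rw [key, key] at h
  convert h using 4
  ext j k
  rw [Matrix.of_apply]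
  change X j k = ((z j : ℂ) - w k) / (z j - w k) * X j k
  rw [div_self (sub_ne_zero.2 (hzw j k)), one_mul]

end OpLip

/-! ### Commutator Lipschitz functions are analytic -/

namespace OpLip

open Filter Topology Finset

theorem sum_inv_sub_eq (j : ℕ) :
    ∑ k ∈ range j, (1 : ℝ) / ((j : ℝ) - k) = ∑ i ∈ range j, 1 / ((i : ℝ) + 1) := by
  rw [← sum_range_reflect]
  refine sum_congr rfl fun i hi => ?_
  have hi := mem_range.1 hi
  rw [show j - 1 - i = j - (i + 1) by omega, Nat.cast_sub (by omega)]
  push_cast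
  congr 1
  ring

/-- Each of the `N` rows `j ≥ N` contains the whole harmonic sum of length `N`; this is the `n log
n` growth. -/
theorem mul_sum_le_sum_sum (N : ℕ) :
    (N : ℝ) * ∑ i ∈ range N, 1 / ((i : ℝ) + 1) ≤
      ∑ j ∈ range (2 * N), ∑ k ∈ range j, (1 : ℝ) / ((j : ℝ) - k) := by
  have hmono : ∀ j, N ≤ j →
      ∑ i ∈ range N, 1 / ((i : ℝ) + 1) ≤ ∑ k ∈ range j, (1 : ℝ) / ((j : ℝ) - k) := fun j hj => by
    rw [sum_inv_sub_eq]
    exact sum_le_sum_of_subset_of_nonneg (range_mono hj) fun i _ _ => by positivity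
  rw [two_mul, sum_range_add]
  have h1 : 0 ≤ ∑ j ∈ range N, ∑ k ∈ range j, (1 : ℝ) / ((j : ℝ) - k) :=
    sum_nonneg fun j _ => by rw [sum_inv_sub_eq]; exact sum_nonneg fun i _ => by positivity
  have h2 := card_nsmul_le_sum (range N)
    (fun i => ∑ k ∈ range (N + i), (1 : ℝ) / (((N + i : ℕ) : ℝ) - k)) _
    fun i _ => hmono (N + i) (by omega)
  rw [card_range, nsmul_eq_mul] at h2
  linarith

/-- The Hilbert matrix against a triangular pattern of two values. -/
theorem sum_triangular_hilbert (a b : ℂ) (n : ℕ) :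
    ∑ j ∈ range n, ∑ k ∈ range n,
      (if j ≤ k then a else b) * (Complex.I / (((k : ℤ) - (j : ℤ) : ℤ) : ℂ)) =
      Complex.I * (a - b) * (∑ j ∈ range n, ∑ k ∈ range j, (1 : ℝ) / ((j : ℝ) - k) : ℝ) := by
  set x : ℕ → ℕ → ℂ := fun j k => Complex.I / (((k : ℤ) - (j : ℤ) : ℤ) : ℂ) with hx
  -- Antisymmetry folds the upper triangle onto the lower one; the diagonal vanishes because `I / 0
  -- = 0`.
  have hanti : ∀ j k, x j k = -x k j := fun j k => by
    simp only [hx]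
    rw [← neg_sub (j : ℤ) k, Int.cast_neg, div_neg]
  have htri : ∀ g : ℕ → ℕ → ℂ, ∑ j ∈ range n, ∑ k ∈ range n, (if k < j then g j k else 0) =
      ∑ j ∈ range n, ∑ k ∈ range j, g j k := fun g => by
    refine sum_congr rfl fun j hj => ?_
    have hj := mem_range.1 hj
    rw [← sum_filter]
    congr 1
    ext k
    simp only [mem_filter, mem_range]
    omega
  have hsplit : ∀ j k, (if j ≤ k then a else b) * x j k =
      (if j < k then a * x j k else 0) + (if k < j then b * x j k else 0) := fun j k => by
    rcases lt_trichotomy j k with h | h | h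
    · simp [h, h.le, h.not_gt]
    · simp [h, hx]
    · simp [h, h.not_ge, h.not_gt]
  change ∑ j ∈ range n, ∑ k ∈ range n, (if j ≤ k then a else b) * x j k = _
  simp only [hsplit, sum_add_distrib]
  rw [sum_comm, htri, htri, ← sum_add_distrib, Complex.ofReal_sum, mul_sum]
  refine sum_congr rfl fun j _ => ?_
  rw [← sum_add_distrib, Complex.ofReal_sum, mul_sum]
  refine sum_congr rfl fun k _ => ?_
  rw [hanti j k]
  simp only [hx]
  push_cast
  ring

/-- A triangular pattern with two different values is not a bounded Schur multiplier. -/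
theorem eq_of_triangular_bound {a b : ℂ} {K : ℝ}
    (h : ∀ n : ℕ, ‖∑ j ∈ range n, ∑ k ∈ range n,
      (if j ≤ k then a else b) * (Complex.I / (((k : ℤ) - (j : ℤ) : ℤ) : ℂ))‖ ≤ K * n) :
    a = b := by
  by_contra hab
  have hpos : 0 < ‖a - b‖ := norm_pos_iff.2 (sub_ne_zero.2 hab)
  -- At `n = 2 N` the hypothesis gives `‖a - b‖ * N * H_N ≤ 2 * K * N`, with `H_N` the harmonic sum,
  -- so `H_N > 2 K / ‖a - b‖` is contradictory.
  obtain ⟨N, hN, hN0⟩ := ((Real.tendsto_sum_range_one_div_nat_succ_atTop.eventually_gt_atTop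
    (2 * K / ‖a - b‖)).and (eventually_gt_atTop 0)).exists
  have h1 := h (2 * N)
  have h2 := mul_sum_le_sum_sum N
  have hN0 : (0 : ℝ) < N := Nat.cast_pos.2 hN0
  rw [sum_triangular_hilbert, norm_mul, norm_mul, Complex.norm_I, one_mul, Complex.norm_real]
    at h1
  have h3 := (mul_le_mul_of_nonneg_left (h2.trans (Real.le_norm_self _)) hpos.le).trans h1
  rw [div_lt_iff₀ hpos] at hN
  push_cast at h3
  nlinarith

/-- The case of `1 × 1` matrices in the Schur bound. -/
theorem CommLipWith.norm_divided_le {F : Set ℂ} [CompactSpace F] {C : ℝ≥0} {f : C(F, ℂ)}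
    (hf : CommLipWith.{u} C f) {z w : F} (hzw : (z : ℂ) ≠ w) :
    ‖(f z - f w) / ((z : ℂ) - w)‖ ≤ C := by
  have h := hf.norm_schur_le (ι := PUnit.{u + 1}) (fun _ => z) (fun _ => w) (fun _ _ => hzw) 1
  have h1 := norm_sum_entries_le (Matrix.of fun j k : PUnit.{u + 1} =>
    (f z - f w) / ((z : ℂ) - w) * (1 : Matrix PUnit.{u + 1} PUnit.{u + 1} ℂ) j k)
  rw [map_one] at h
  simp only [univ_unique, sum_singleton, Matrix.of_apply, Matrix.one_apply_eq, mul_one,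
    Fintype.card_unique, Nat.cast_one, one_mul] at h1 h
  exact h1.trans (h.trans (mul_le_of_le_one_right C.2 ContinuousLinearMap.norm_id_le))

/-- The divided difference at two points at very different distances from a base point is close
to the slope at the remote one. -/
theorem norm_divided_sub_le {C ε : ℝ} {c P Q s t φ : ℂ} (hs : s ≠ 0)
    (hst : ‖t‖ ≤ ε * ‖s‖) (hε : ε ≤ 1 / 2) (hP : ‖P - c‖ ≤ ε) (hPC : ‖P‖ ≤ C) (hQC : ‖Q‖ ≤ C)
    (hφ : φ * (s - t) = P * s - Q * t) : ‖φ - c‖ ≤ (1 + 4 * C) * ε := by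
  have hs0 : 0 < ‖s‖ := norm_pos_iff.2 hs
  have h1 : ‖φ - P‖ * ‖s - t‖ = ‖P - Q‖ * ‖t‖ := by
    rw [← norm_mul, ← norm_mul]
    congr 1
    linear_combination hφ
  have h2 : ‖s‖ / 2 ≤ ‖s - t‖ := by
    have := norm_sub_norm_le s t
    nlinarith
  have h3 : ‖P - Q‖ ≤ 2 * C := (norm_sub_le _ _).trans (by linarith)
  have h4 : ‖φ - P‖ * (‖s‖ / 2) ≤ 2 * C * (ε * ‖s‖) := calc
    _ ≤ ‖φ - P‖ * ‖s - t‖ := by gcongr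
    _ = ‖P - Q‖ * ‖t‖ := h1
    _ ≤ 2 * C * (ε * ‖s‖) := mul_le_mul h3 hst (norm_nonneg _) ((norm_nonneg _).trans h3)
  have h5 : ‖φ - P‖ ≤ 4 * C * ε := by
    refine le_of_mul_le_mul_right (a := ‖s‖ / 2) (h4.trans_eq (by ring)) (by positivity)
  calc ‖φ - c‖ = ‖(φ - P) + (P - c)‖ := by rw [sub_add_sub_cancel]
    _ ≤ 4 * C * ε + ε := (norm_add_le _ _).trans (add_le_add h5 hP)
    _ = (1 + 4 * C) * ε := by ring

theorem exists_interlaced_seq {z₀ : ℂ} (hz₀ : z₀ ∈ Metric.ball (0 : ℂ) 1) {S : ℂ → ℂ} {c : ℕ → ℂ}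
    (hc : ∀ i, MapClusterPt (c i) (𝓝[≠] z₀) S) {ε : ℝ} (hε : 0 < ε) :
    ∃ ζ : ℕ → ℂ, (∀ i, ζ i ≠ z₀ ∧ ζ i ∈ Metric.ball (0 : ℂ) 1 ∧ ‖S (ζ i) - c i‖ ≤ ε) ∧
      ∀ i, ‖ζ (i + 1) - z₀‖ ≤ ε * ‖ζ i - z₀‖ := by
  -- The premise `0 < δ` sits inside the existential, so the recursion can be written before its
  -- distances are known to be positive.
  have step : ∀ (i : ℕ) (δ : ℝ), ∃ ζ : ℂ, 0 < δ → (ζ ≠ z₀ ∧ ζ ∈ Metric.ball (0 : ℂ) 1 ∧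
      ‖S ζ - c i‖ ≤ ε) ∧ ‖ζ - z₀‖ ≤ δ := fun i δ => by
    rcases le_or_gt δ 0 with hδ | hδ
    · exact ⟨0, fun h => absurd h hδ.not_gt⟩
    · have h1 := (hc i).frequently (Metric.closedBall_mem_nhds (c i) hε)
      have h2 : ∀ᶠ z in 𝓝[≠] z₀, z ≠ z₀ ∧ z ∈ Metric.ball (0 : ℂ) 1 ∧
          z ∈ Metric.closedBall z₀ δ :=
        (eventually_mem_nhdsWithin).and ((eventually_nhdsWithin_of_eventually_nhds
          (Metric.isOpen_ball.mem_nhds hz₀)).and (eventually_nhdsWithin_of_eventually_nhds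
          (Metric.closedBall_mem_nhds z₀ hδ)))
      obtain ⟨ζ, hζ, hζ1, hζ2, hζ3⟩ := (h1.and_eventually h2).exists
      exact ⟨ζ, fun _ => ⟨⟨hζ1, hζ2, mem_closedBall_iff_norm.1 hζ⟩,
        mem_closedBall_iff_norm.1 hζ3⟩⟩
  choose g hg using step
  let ζ : ℕ → ℂ := fun n => Nat.rec (g 0 1) (fun i z => g (i + 1) (ε * ‖z - z₀‖)) n
  have hpos : ∀ i, ζ i ≠ z₀ → 0 < ε * ‖ζ i - z₀‖ := fun i hi =>
    mul_pos hε (norm_pos_iff.2 (sub_ne_zero.2 hi))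
  have hζ : ∀ i, ζ i ≠ z₀ ∧ ζ i ∈ Metric.ball (0 : ℂ) 1 ∧ ‖S (ζ i) - c i‖ ≤ ε := fun i => by
    induction i with
    | zero => exact (hg 0 1 one_pos).1
    | succ i ih => exact (hg (i + 1) _ (hpos i ih.1)).1
  exact ⟨ζ, hζ, fun i => (hg (i + 1) _ (hpos i (hζ i).1)).2⟩

/-- The index types in `CommLipWith.norm_schur_le` lie in `Type u`, whence the lift of `Fin n`. -/
theorem sum_ulift_fin {M : Type*} [AddCommMonoid M] (n : ℕ) (g : ℕ → M) :
    ∑ i : ULift.{u} (Fin n), g i.down = ∑ i ∈ range n, g i := by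
  rw [← Fin.sum_univ_eq_sum_range]
  exact Equiv.ulift.sum_comp fun i : Fin n => g i

section Slope

variable {C : ℝ≥0} {f : C(closedDisc, ℂ)} {z₀ : ℂ}

theorem CommLipWith.norm_slope_le (hf : CommLipWith.{u} C f) (hz₀ : z₀ ∈ Metric.ball (0 : ℂ) 1)
    {z : ℂ} (hz : z ∈ Metric.ball (0 : ℂ) 1) (hne : z ≠ z₀) : ‖slope (ext₀ f) z₀ z‖ ≤ C := by
  have h := hf.norm_divided_le (z := ⟨z, Metric.ball_subset_closedBall hz⟩)
    (w := ⟨z₀, Metric.ball_subset_closedBall hz₀⟩) hne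
  rwa [← ext₀_apply, ← ext₀_apply, ← slope_def_field] at h

/-- Choose points collapsing fast to `z₀`, with slopes near `a` at even indices and near `b` at odd
ones. The quotient between two of them is close to the slope at the farther, that is earlier, point.
With rows `2 j` and columns `2 k + 1` the row point is the earlier one exactly when `j ≤ k`, so the
quotients approximate the triangular pattern. The Schur bound on the Hilbert matrix gives the first
term, the `n ^ 2` approximation errors the second. -/
theorem CommLipWith.norm_triangular_sum_le (hf : CommLipWith.{u} C f)
    (hz₀ : z₀ ∈ Metric.ball (0 : ℂ) 1) {a b : ℂ}
    (ha : MapClusterPt a (𝓝[≠] z₀) (slope (ext₀ f) z₀))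
    (hb : MapClusterPt b (𝓝[≠] z₀) (slope (ext₀ f) z₀)) (n : ℕ) {ε : ℝ} (hε : 0 < ε)
    (hε2 : ε ≤ 1 / 2) :
    ‖∑ j ∈ range n, ∑ k ∈ range n,
      (if j ≤ k then a else b) * (Complex.I / (((k : ℤ) - (j : ℤ) : ℤ) : ℂ))‖ ≤
      C * Real.pi * n + n * (n * ((1 + 4 * C) * ε)) := by
  obtain ⟨ζ, hζ, hstep⟩ := exists_interlaced_seq hz₀ (S := slope (ext₀ f) z₀)
    (c := fun i => if Even i then a else b) (fun i => by split_ifs <;> assumption) hε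
  have hdec : ∀ i d, ‖ζ (i + d + 1) - z₀‖ ≤ ε * ‖ζ i - z₀‖ := fun i d => by
    induction d with
    | zero => exact hstep i
    | succ d ih =>
      refine (hstep (i + d + 1)).trans ((mul_le_of_le_one_left (norm_nonneg _) ?_).trans ih)
      linarith
  have hdec' : ∀ i l, i < l → ‖ζ l - z₀‖ ≤ ε * ‖ζ i - z₀‖ := fun i l h => by
    obtain ⟨d, rfl⟩ := Nat.exists_eq_add_of_lt h
    exact hdec i d
  have hne : ∀ i l, i < l → ζ i ≠ ζ l := fun i l h heq => by
    have h1 := hdec' i l h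
    have h2 : 0 < ‖ζ i - z₀‖ := norm_pos_iff.2 (sub_ne_zero.2 (hζ i).1)
    rw [← heq] at h1
    nlinarith
  have hslope : ∀ i, slope (ext₀ f) z₀ (ζ i) * (ζ i - z₀) = ext₀ f (ζ i) - ext₀ f z₀ := fun i => by
    rw [slope_def_field, div_mul_cancel₀ _ (sub_ne_zero.2 (hζ i).1)]
  have hdiv : ∀ i l, i < l → ‖(ext₀ f (ζ i) - ext₀ f (ζ l)) / (ζ i - ζ l) -
      if Even i then a else b‖ ≤ (1 + 4 * C) * ε := fun i l h => by
    refine norm_divided_sub_le (sub_ne_zero.2 (hζ i).1) (hdec' i l h) hε2 (hζ i).2.2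
      (hf.norm_slope_le hz₀ (hζ i).2.1 (hζ i).1) (hf.norm_slope_le hz₀ (hζ l).2.1 (hζ l).1) ?_
    rw [hslope, hslope, sub_sub_sub_cancel_right, sub_sub_sub_cancel_right,
      div_mul_cancel₀ _ (sub_ne_zero.2 (hne i l h))]
  set x : ℕ → ℕ → ℂ := fun j k => Complex.I / (((k : ℤ) - (j : ℤ) : ℤ) : ℂ) with hx
  set φ : ℕ → ℕ → ℂ := fun j k =>
    (ext₀ f (ζ (2 * j)) - ext₀ f (ζ (2 * k + 1))) / (ζ (2 * j) - ζ (2 * k + 1))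
  have hφ : ∀ j k, ‖(if j ≤ k then a else b) - φ j k‖ ≤ (1 + 4 * C) * ε := fun j k => by
    rw [norm_sub_rev]
    split_ifs with h
    · simpa using hdiv (2 * j) (2 * k + 1) (by omega)
    · have := hdiv (2 * k + 1) (2 * j) (by omega)
      rw [if_neg (by simp), ← neg_sub (ext₀ f (ζ (2 * j))), ← neg_sub (ζ (2 * j)),
        neg_div_neg_eq] at this
      exact this
  have hx1 : ∀ j k, ‖x j k‖ ≤ 1 := norm_hilbertMatrix_apply_le (fun j : ℕ => (j : ℤ))
  let pt : ℕ → closedDisc := fun i => ⟨ζ i, Metric.ball_subset_closedBall (hζ i).2.1⟩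
  let v : ULift.{u} (Fin n) → ℤ := fun i => ((i.down : ℕ) : ℤ)
  have hv : Function.Injective v := fun i j h => by
    exact ULift.ext _ _ (Fin.ext (Int.ofNat.inj h))
  have hmain : ‖∑ j ∈ range n, ∑ k ∈ range n, φ j k * x j k‖ ≤ n * (C * Real.pi) := by
    have h1 := hf.norm_schur_le (ι := ULift.{u} (Fin n)) (fun j => pt (2 * j.down))
      (fun k => pt (2 * k.down + 1)) (fun j k => by
        rcases lt_or_gt_of_ne (show 2 * (j.down : ℕ) ≠ 2 * k.down + 1 by omega) with h | h
        · exact hne _ _ h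
        · exact (hne _ _ h).symm) (hilbertMatrix v)
    have h2 := (norm_sum_entries_le _).trans (mul_le_mul_of_nonneg_left
      (h1.trans (mul_le_mul_of_nonneg_left (norm_hilbertMatrix_le hv) C.2)) (Nat.cast_nonneg _))
    rw [Fintype.card_ulift, Fintype.card_fin] at h2
    refine le_of_eq_of_le (congrArg _ ?_) h2
    rw [← sum_ulift_fin.{u} n fun j => ∑ k ∈ range n, φ j k * x j k]
    refine sum_congr rfl fun j _ => ?_
    rw [← sum_ulift_fin.{u} n fun k => φ j.down k * x j.down k]
    refine sum_congr rfl fun k _ => ?_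
    rw [Matrix.of_apply, ← ext₀_apply, ← ext₀_apply]
    rfl
  have herr : ‖∑ j ∈ range n, ∑ k ∈ range n, ((if j ≤ k then a else b) - φ j k) * x j k‖ ≤
      n * (n * ((1 + 4 * C) * ε)) := by
    refine (norm_sum_le_of_le _ (fun j _ => norm_sum_le_of_le _ (fun k _ =>
      (norm_mul_le _ _).trans (mul_le_mul (hφ j k) (hx1 j k) (norm_nonneg _)
        (by positivity))))).trans (by simp)
  calc _ = ‖∑ j ∈ range n, ∑ k ∈ range n, φ j k * x j k +
        ∑ j ∈ range n, ∑ k ∈ range n, ((if j ≤ k then a else b) - φ j k) * x j k‖ := by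
        congr 1
        rw [← sum_add_distrib]
        refine sum_congr rfl fun j _ => ?_
        rw [← sum_add_distrib]
        refine sum_congr rfl fun k _ => ?_
        rw [← add_mul, add_sub_cancel]
    _ ≤ n * (C * Real.pi) + n * (n * ((1 + 4 * C) * ε)) :=
        (norm_add_le _ _).trans (add_le_add hmain herr)
    _ = _ := by ring

/-- With `n` fixed, `ε → 0` removes the quadratic error and leaves a bound linear in `n`. -/
theorem CommLipWith.eq_of_mapClusterPt_slope (hf : CommLipWith.{u} C f)
    (hz₀ : z₀ ∈ Metric.ball (0 : ℂ) 1) {a b : ℂ}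
    (ha : MapClusterPt a (𝓝[≠] z₀) (slope (ext₀ f) z₀))
    (hb : MapClusterPt b (𝓝[≠] z₀) (slope (ext₀ f) z₀)) : a = b := by
  refine eq_of_triangular_bound (K := C * Real.pi) fun n => ?_
  have hc : Continuous fun ε : ℝ => C * Real.pi * n + n * (n * ((1 + 4 * C) * ε)) := by fun_prop
  have hlim := (hc.tendsto 0).mono_left (nhdsWithin_le_nhds (s := Set.Ioi 0))
  simp only [mul_zero, add_zero] at hlim
  refine ge_of_tendsto hlim ?_
  filter_upwards [Ioc_mem_nhdsGT (show (0 : ℝ) < 1 / 2 by norm_num)] with ε hε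
  exact hf.norm_triangular_sum_le hz₀ ha hb n hε.1 hε.2

/-- A commutator Lipschitz function on the closed disc belongs to the disc algebra. -/
theorem CommLipWith.mem_discAlgebra (hf : CommLipWith.{u} C f) : f ∈ discAlgebra := by
  refine DifferentiableOn.analyticOnNhd (fun z₀ hz₀ => ?_) Metric.isOpen_ball
  have hmem : ∀ᶠ z in 𝓝[≠] z₀, slope (ext₀ f) z₀ z ∈ Metric.closedBall (0 : ℂ) C := by
    filter_upwards [self_mem_nhdsWithin,
      mem_nhdsWithin_of_mem_nhds (Metric.isOpen_ball.mem_nhds hz₀)] with z h1 h2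
    exact mem_closedBall_zero_iff.2 (hf.norm_slope_le hz₀ h2 h1)
  -- Slopes stay in a compact disc, so a cluster value exists; its uniqueness makes it the
  -- derivative.
  obtain ⟨a, -, ha⟩ := (isCompact_closedBall (0 : ℂ) (C : ℝ)).exists_mapClusterPt
    (le_principal_iff.2 (mem_map.2 hmem))
  have hlim := (isCompact_closedBall (0 : ℂ) (C : ℝ)).tendsto_nhds_of_unique_mapClusterPt hmem
    fun b _ hb => hf.eq_of_mapClusterPt_slope hz₀ hb ha
  exact (hasDerivAt_iff_tendsto_slope.2 hlim).differentiableAt.differentiableWithinAt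

end Slope

end OpLip

/-! ### Equality of the seminorms and the restriction map -/

namespace OpLip

theorem commLipWith_circle_iff {C : ℝ≥0} {f : C(unitCircle, ℂ)} :
    CommLipWith.{u} C f ↔ OpLipWith.{u} C f :=
  ⟨fun h => h.opLipWith, fun h => h.commLipWith⟩

theorem commLipWith_disc_iff {C : ℝ≥0} {f : C(closedDisc, ℂ)} (hf : f ∈ discAlgebra) :
    CommLipWith.{u} C f ↔ CommLipWith.{u} C (toCircle f) :=
  ⟨fun h => h.restrictTo _, fun h => h.of_toCircle hf⟩

theorem normCL_toCircle {f : C(closedDisc, ℂ)} (hf : f ∈ discAlgebra) :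
    normCL.{u} (toCircle f) = normCL.{u} f := by
  simp only [normCL, commLipWith_disc_iff hf]

theorem normCL_eq_normOL (f : C(unitCircle, ℂ)) : normCL.{u} f = normOL.{u} f := by
  simp only [normCL, normOL, commLipWith_circle_iff]

theorem mem_CL_iff_toCircle_mem_OL {f : C(closedDisc, ℂ)} (hf : f ∈ discAlgebra) :
    f ∈ CL.{u} closedDisc ↔ toCircle f ∈ OL.{u} unitCircle :=
  exists_congr fun _ => (commLipWith_disc_iff hf).trans commLipWith_circle_iff

theorem mem_discAlgebra_of_mem_CL {f : C(closedDisc, ℂ)} (hf : f ∈ CL.{u} closedDisc) :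
    f ∈ discAlgebra :=
  hf.elim fun _ h => h.mem_discAlgebra

theorem eq_zero_of_toCircle_eq_zero {f : C(closedDisc, ℂ)} (hf : f ∈ discAlgebra)
    (h : toCircle f = 0) : f = 0 := by
  ext z
  have hz : (z : ℂ) ∈ closure (Metric.ball (0 : ℂ) 1) := by
    rw [closure_ball _ one_ne_zero]
    exact z.2
  have := Complex.norm_le_of_forall_mem_frontier_norm_le Metric.isBounded_ball
    (diffContOnCl_ext₀ hf) (C := 0) (fun w hw => ?_) hz
  · rw [ext₀_apply] at this
    simpa using this
  · rw [frontier_ball _ one_ne_zero] at hw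
    have h1 : ext₀ f w = toCircle f ⟨w, hw⟩ :=
      ext₀_apply f ⟨w, Metric.sphere_subset_closedBall hw⟩
    rw [h1, h]
    simp

/-- The restriction of commutator Lipschitz functions on the disc to the circle. -/
def restrictCL : CL.{u} closedDisc →ₗ[ℂ] OLplus.{u} :=
  (toCircle.comp (CL.{u} closedDisc).subtype).codRestrict OLplus.{u} fun f =>
    ⟨(mem_CL_iff_toCircle_mem_OL (mem_discAlgebra_of_mem_CL f.2)).1 f.2,
      f, mem_discAlgebra_of_mem_CL f.2, rfl⟩

theorem restrictCL_bijective : Function.Bijective restrictCL.{u} := by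
  refine ⟨(injective_iff_map_eq_zero _).2 fun f hf => ?_, ?_⟩
  · exact Subtype.ext (eq_zero_of_toCircle_eq_zero (mem_discAlgebra_of_mem_CL f.2)
      (congrArg Subtype.val hf))
  · rintro ⟨_, hOL, f, hf, rfl⟩
    exact ⟨⟨f, (mem_CL_iff_toCircle_mem_OL hf).2 hOL⟩, rfl⟩

end OpLip

end
theorem mainTheorem11 :
    (∀ f : C(OpLip.closedDisc, ℂ), f ∈ OpLip.CL.{u} OpLip.closedDisc →
      f ∈ OpLip.discAlgebra ∧
      OpLip.normCL.{u} f = OpLip.normCL.{u} (OpLip.toCircle f) ∧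
      OpLip.normCL.{u} (OpLip.toCircle f) = OpLip.normOL.{u} (OpLip.toCircle f)) ∧
    (∀ f : C(OpLip.closedDisc, ℂ), f ∈ OpLip.discAlgebra →
      (f ∈ OpLip.CL.{u} OpLip.closedDisc ↔
        OpLip.toCircle f ∈ OpLip.OL.{u} OpLip.unitCircle)) ∧
    (∃ Φ : OpLip.CL.{u} OpLip.closedDisc ≃ₗ[ℂ] OpLip.OLplus.{u},
      ∀ f : OpLip.CL.{u} OpLip.closedDisc,
        (Φ f : C(OpLip.unitCircle, ℂ)) = OpLip.toCircle (f : C(OpLip.closedDisc, ℂ)) ∧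
        OpLip.normOL.{u} (Φ f : C(OpLip.unitCircle, ℂ)) =
          OpLip.normCL.{u} (f : C(OpLip.closedDisc, ℂ))) := by
  refine ⟨fun f hf => ?_, fun f hf => OpLip.mem_CL_iff_toCircle_mem_OL hf,
    LinearEquiv.ofBijective OpLip.restrictCL OpLip.restrictCL_bijective, fun f => ⟨rfl, ?_⟩⟩
  · have hA := OpLip.mem_discAlgebra_of_mem_CL hf
    exact ⟨hA, (OpLip.normCL_toCircle hA).symm, OpLip.normCL_eq_normOL _⟩
  · exact (OpLip.normCL_eq_normOL _).symm.trans
      (OpLip.normCL_toCircle (OpLip.mem_discAlgebra_of_mem_CL f.2))
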